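/- Let $S$ be a (discrete) monoid, let $A$ be a finite alphabet with the discrete topology, and let $A^S$ carry the product topology and the shift action $(s\omega)(t)=\omega(ts)$. Let $X\subseteq A^S$ be a subshift, that is, a closed $S$-invariant subset. For $K\subseteq S$ let $\pi_K:A^S\to A^K$ be the restriction map. The following four conditions are equivalent. 1. $(S,X)$ is tame: for every continuous $f:X\to\mathbb R$, the family $fS=\{x\mapsto f(sx): s\in S\}$ contains no independent sequence. (A sequence $f_n:X\to\mathbb R$ is independent if there are reals $a<b$ such that $\bigcap_{n\in P}f_n^{-1}(-\infty,a)\cap\bigcap_{n\in M}f_n^{-1}(b,\infty)\neq\emptyset$ for all finite disjoint $P,M\subseteq\mathbb N$.) 2. For every infinite $L\subseteq S$ there exist an infinite $K\subseteq L$ and a countable $Y\subseteq X$ such that $\pi_K(X)=\pi_K(Y)$. 3. For every infinite $L\subseteq S$ there exists an infinite $K\subseteq L$ such that $\pi_K(X)$ is countable. 4. $(S,X)$ is Rosenthal representable (WRN): there are a real Banach space $V$ that contains no isomorphic copy of $\ell_1$, a map $h$ from $S$ to the linear operators on $V$ of norm at most $1$ with $h(e)=\mathrm{id}$ and $h(st)=h(t)h(s)$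 for all $s,t \in S$, and a bounded map $\alpha:X\to V^*$ that is a topological embedding for the weak-star topology and satisfies $\langle v,\alpha(sx)\rangle=\langle h(s)v,\alpha(x)\rangle$ for all $s\in S$, $x\in X$, $v\in V$. -/

import Mathlib

open Set Topology
open scoped ENNReal

universe u v

/-! ## Tame systems

A dynamical system of the discrete monoid `S` is a compact space `X` with a monoid action of `S`
by continuous maps, i.e. `[MulAction S X] [ContinuousConstSMul S X]`. -/

/-- A sequence of real functions on a set is independent if there are reals `a < b` such that
`⋂_{n ∈ P} f_n⁻¹(-∞, a) ∩ ⋂_{n ∈ M} f_n⁻¹(b, ∞) ≠ ∅` for all finite disjoint `P, M ⊆ ℕ`. -/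
def IsIndependentSeq {X : Type*} (f : ℕ → X → ℝ) : Prop :=
  ∃ a b : ℝ, a < b ∧ ∀ P M : Finset ℕ, Disjoint P M →
    ((⋂ n ∈ P, f n ⁻¹' Iio a) ∩ (⋂ n ∈ M, f n ⁻¹' Ioi b)).Nonempty

/-- The orbit `fS = {fs : s ∈ S}` of a real function `f` on `X`, where `(fs)(x) = f (s x)`. -/
def functionOrbit (S : Type*) {X : Type*} [Monoid S] [MulAction S X] (f : X → ℝ) :
    Set (X → ℝ) :=
  range fun (s : S) (x : X) => f (s • x)

/-- The system `(S, X)` is tame if for every `f ∈ C(X)` the family `fS` contains no independent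
sequence. -/
def IsTameSystem (S X : Type*) [Monoid S] [TopologicalSpace X] [MulAction S X] : Prop :=
  ∀ f : C(X, ℝ), ∀ g : ℕ → X → ℝ, (∀ n, g n ∈ functionOrbit S f) → ¬ IsIndependentSeq g

/-! ## Representations on Banach spaces -/

/-- A Banach space is Rosenthal if it contains no isomorphic copy of `ℓ¹`. -/
def IsRosenthalSpace (V : Type*) [NormedAddCommGroup V] [NormedSpace ℝ V] : Prop :=
  ¬ ∃ T : lp (fun _ : ℕ => ℝ) 1 →L[ℝ] V, IsEmbedding T

/-- A representation of the system `(S, X)` (with `S` discrete) on the Banach space `V`: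
a monoid co-homomorphism `h` from `S` to the linear contractions of `V`, and a bounded weak-star
continuous map `α : X → V*` which is equivariant, `⟨v, α (s x)⟩ = ⟨h(s) v, α x⟩`. -/
structure BanachRepresentation (S X V : Type*) [Monoid S] [TopologicalSpace X] [MulAction S X]
    [NormedAddCommGroup V] [NormedSpace ℝ V] where
  h : S →* (V →L[ℝ] V)ᵐᵒᵖ
  contraction : ∀ s, ‖(h s).unop‖ ≤ 1
  α : X → WeakDual ℝ V
  continuous_α : Continuous α
  bounded_α : ∃ C : ℝ, ∀ x, ‖WeakDual.toStrongDual (α x)‖ ≤ C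
  equivariant : ∀ (s : S) (x : X) (v : V), α (s • x) v = α x ((h s).unop v)

/-- `(S, X)` is Rosenthal representable (WRN): it has a faithful representation (`α` is a
topological embedding into `V*` with the weak-star topology) on some Rosenthal Banach space. -/
def IsRosenthalRepresentable (S : Type u) (X : Type v) [Monoid S] [TopologicalSpace X]
    [MulAction S X] : Prop :=
  ∃ (V : Type v) (_ : NormedAddCommGroup V) (_ : NormedSpace ℝ V) (_ : CompleteSpace V),
    IsRosenthalSpace V ∧ ∃ ρ : BanachRepresentation S X V, IsEmbedding ρ.α

/-! ## Subshifts -/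

/-- The shift action on `A^S`: `(s ω)(t) = ω (t s)`. -/
def shift {S : Type u} {A : Type v} [Monoid S] (s : S) (ω : S → A) : S → A := fun t => ω (t * s)

/-- A subshift of `A^S`: a closed shift-invariant subset. -/
structure Subshift (S : Type u) (A : Type v) [Monoid S] [TopologicalSpace A] where
  carrier : Set (S → A)
  isClosed : IsClosed carrier
  shift_mem : ∀ (s : S) (ω : S → A), ω ∈ carrier → shift s ω ∈ carrier

namespace Subshift

variable {S : Type u} {A : Type v} [Monoid S] [TopologicalSpace A]

/-- The underlying space of a subshift, with the topology induced by the product topology. -/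
abbrev Points (X : Subshift S A) : Type (max u v) := {ω : S → A // ω ∈ X.carrier}

instance (X : Subshift S A) : MulAction S X.Points where
  smul s ω := ⟨shift s ω.1, X.shift_mem s ω.1 ω.2⟩
  one_smul ω := Subtype.ext (funext fun t => congrArg ω.1 (mul_one t))
  mul_smul s t ω := Subtype.ext (funext fun r => congrArg ω.1 (mul_assoc r s t).symm)

theorem coe_smul (X : Subshift S A) (s : S) (ω : X.Points) : (s • ω).1 = shift s ω.1 := rfl

instance (X : Subshift S A) : ContinuousConstSMul S X.Points where
  continuous_const_smul s :=
    continuous_induced_rng.2 (continuous_pi fun t =>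
      (continuous_apply (t * s)).comp continuous_subtype_val)

end Subshift

/-! The hub of the equivalence is `Subshift.IsNonOscillating`: every infinite set of coordinates
contains an infinite subset along which each point of `X` is constant off a finite set. Since `x s`
is the coordinate at `1` of `s • x`, the coordinates form the orbit of a single finite-valued
function. Rosenthal's dichotomy, deduced from the open Ramsey theorem, says that an infinite family
of functions contains either an independent sequence or an infinite subfamily that nowhere
oscillates across two given levels; so tameness excludes oscillation. Eventually constant words on a
countable index set are countably many, hence the restrictions are countable. Conversely, an
independent sequence realizes continuum many patterns, and these are already visible in finitely
many coordinates of the translates, which contradicts countability.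

A copy of `ℓ¹` in a representing space is what an independent sequence of matrix coefficients would
produce, so a Rosenthal representation also excludes oscillation. For the construction of one, take
in `C(X)` the absolutely convex hull of the coordinate indicators and form its
Davis–Figiel–Johnson–Pełczyński space. Two facts show that it contains no `ℓ¹`. In
`not_hasLowerL1Estimate_of_approx`, a sequence of `ℓ¹` type would define a seminorm that separates
it, while non-oscillation makes the indicators, and with them their hull, totally bounded for this
seminorm. In `BoundedDisc.isRosenthalSpace_interp`, an `ℓ¹` sequence of the interpolation space
would therefore have normalized blocks that are small in `C(X)`; such blocks are almost orthogonal
in the `ℓ²`-sum, so sums of `k` of them grow like `√k` and not like `k`. -/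

/-! ## The open Ramsey theorem for subsequences, and the dichotomy of Rosenthal -/

/-- The first `k` terms of a sequence of natural numbers. -/
def seqPrefix (P : ℕ → ℕ) (k : ℕ) : List ℕ := (List.range k).map P

theorem seqPrefix_succ (P : ℕ → ℕ) (k : ℕ) :
    seqPrefix P (k + 1) = seqPrefix P k ++ [P k] := by
  simp [seqPrefix, List.range_succ]

theorem seqPrefix_succ' (P : ℕ → ℕ) (k : ℕ) :
    seqPrefix P (k + 1) = P 0 :: seqPrefix (fun n => P (n + 1)) k := by
  simp [seqPrefix, List.range_succ_eq_map, Function.comp_def]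

/-- `F` is a bar for some tree whose nodes have successor sets in the ultrafilter `U`. -/
def IsTreeBar (U : Ultrafilter ℕ) (F : Set (List ℕ)) : Prop :=
  ∃ A : List ℕ → Set ℕ, (∀ t, A t ∈ U) ∧
    ∀ P : ℕ → ℕ, (∀ k, P k ∈ A (seqPrefix P k)) → ∃ k, seqPrefix P k ∈ F

/-- The witnessing trees are glued below a root whose successors are the good `n`. The other `n`
receive the full tree, which no branch enters. -/
theorem IsTreeBar.of_eventually {U : Ultrafilter ℕ} {F : Set (List ℕ)}
    (h : {n | IsTreeBar U {t | n :: t ∈ F}} ∈ U) : IsTreeBar U F := by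
  classical
  have h' : ∀ n, ∃ A : List ℕ → Set ℕ, (∀ t, A t ∈ U) ∧ (IsTreeBar U {t | n :: t ∈ F} →
      ∀ P : ℕ → ℕ, (∀ k, P k ∈ A (seqPrefix P k)) → ∃ k, seqPrefix P k ∈ {t | n :: t ∈ F}) := by
    intro n
    by_cases hn : IsTreeBar U {t | n :: t ∈ F}
    · obtain ⟨A, hA, hP⟩ := hn
      exact ⟨A, hA, fun _ => hP⟩
    · exact ⟨fun _ => univ, fun _ => Filter.univ_mem, fun h => absurd h hn⟩
  choose A hA hP using h'
  refine ⟨fun t => match t with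
    | [] => {n | IsTreeBar U {t | n :: t ∈ F}}
    | n :: t => A n t, ?_, ?_⟩
  · rintro (_ | ⟨n, t⟩)
    · exact h
    · exact hA n t
  · intro P hPA
    have h0 := hPA 0
    simp only [seqPrefix, List.range_zero, List.map_nil] at h0
    obtain ⟨k, hk⟩ := hP (P 0) h0 (fun n => P (n + 1)) (fun k => by
      have := hPA (k + 1)
      rw [seqPrefix_succ'] at this
      exact this)
    exact ⟨k + 1, by rw [seqPrefix_succ']; exact hk⟩

/-- Diagonalization: after a term `x`, every later term must lie in `A s` for each of the finitely
many increasing lists `s` of numbers up to `x`. A prefix of any subsequence is such a list, with `x`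
its last entry. -/
theorem exists_strictMono_compatible {U : Ultrafilter ℕ} (hU : (U : Filter ℕ) ≤ Filter.atTop)
    (A : List ℕ → Set ℕ) (hA : ∀ t, A t ∈ U) :
    ∃ m : ℕ → ℕ, StrictMono m ∧ ∀ j : ℕ → ℕ, StrictMono j → ∀ k,
      m (j k) ∈ A (seqPrefix (fun i => m (j i)) k) := by
  obtain ⟨m, hm0, hm⟩ := exists_seq_of_forall_finset_exists (fun y => y ∈ A [])
    (fun x y => x < y ∧ ∀ s ∈ (Finset.range (x + 1)).powerset, y ∈ A (s.sort (· ≤ ·)))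
    (by
      intro s _
      have h1 : ∀ᶠ y in (U : Filter ℕ), ∀ x ∈ s, x < y ∧
          ∀ s ∈ (Finset.range (x + 1)).powerset, y ∈ A (s.sort (· ≤ ·)) := by
        rw [Finset.eventually_all]
        intro x _
        refine Filter.Eventually.and (hU (Filter.eventually_gt_atTop x)) ?_
        rw [Finset.eventually_all]
        intro s _
        exact hA _
      obtain ⟨y, hy⟩ := (Filter.Eventually.and (hA []) h1).exists
      exact ⟨y, hy⟩)
  have hmono : StrictMono m := strictMono_nat_of_lt_succ fun n => (hm n (n + 1) n.lt_succ_self).1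
  refine ⟨m, hmono, fun j hj k => ?_⟩
  rcases k with _ | k
  · simpa [seqPrefix] using hm0 (j 0)
  · have hs : (seqPrefix (fun i => m (j i)) (k + 1)).SortedLT := by
      rw [List.sortedLT_iff_pairwise, seqPrefix, List.pairwise_map]
      exact List.pairwise_lt_range.imp fun h => hmono (hj h)
    have := (hm (j k) (j (k + 1)) (hj k.lt_succ_self)).2
      (seqPrefix (fun i => m (j i)) (k + 1)).toFinset (by
        rw [Finset.mem_powerset]
        intro y hy
        simp only [seqPrefix, List.mem_toFinset, List.mem_map, List.mem_range] at hy
        obtain ⟨i, hi, rfl⟩ := hy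
        exact Finset.mem_range.2 (Nat.lt_succ_of_le (hmono.monotone (hj.monotone (by omega)))))
    rwa [(List.toFinset_sort (· ≤ ·) hs.nodup).2 hs.sortedLE.pairwise] at this

/-- **Open Ramsey theorem**: some infinite set of naturals is such that all its infinite subsets
have an initial segment in `F`, or none has. -/
theorem exists_strictMono_forall_prefix (F : Set (List ℕ)) :
    ∃ m : ℕ → ℕ, StrictMono m ∧
      ((∀ j : ℕ → ℕ, StrictMono j → ∃ k, seqPrefix (fun i => m (j i)) k ∈ F) ∨
        ∀ j : ℕ → ℕ, StrictMono j → ∀ k, seqPrefix (fun i => m (j i)) k ∉ F) := by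
  classical
  let U : Ultrafilter ℕ := Filter.hyperfilter ℕ
  have hU : (U : Filter ℕ) ≤ Filter.atTop := by
    rw [← Nat.cofinite_eq_atTop]; exact Filter.hyperfilter_le_cofinite
  by_cases hF : IsTreeBar U F
  · obtain ⟨A, hA, hP⟩ := hF
    obtain ⟨m, hm, hmA⟩ := exists_strictMono_compatible hU A hA
    exact ⟨m, hm, Or.inl fun j hj => hP _ (hmA j hj)⟩
  -- `G s` is `F` seen from the node `s`. Where it is not a bar, it fails to be one at `U`-almost
  -- all children, so a tree of such nodes exists. No node of this tree is in `F`, since the empty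
  -- continuation would be a bar.
  · let G : List ℕ → Set (List ℕ) := fun s => {t | s ++ t ∈ F}
    have hG : ∀ s, ¬ IsTreeBar U (G s) → {n | ¬ IsTreeBar U (G (s ++ [n]))} ∈ U := by
      intro s hs
      rw [← Ultrafilter.compl_notMem_iff]
      intro h
      refine hs (IsTreeBar.of_eventually ?_)
      convert h using 1
      ext n
      simp [G]
    obtain ⟨m, hm, hmA⟩ := exists_strictMono_compatible hU
      (fun s => if IsTreeBar U (G s) then univ else {n | ¬ IsTreeBar U (G (s ++ [n]))}) (by
        intro s
        split_ifs with h
        · exact Filter.univ_mem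
        · exact hG s h)
    refine ⟨m, hm, Or.inr fun j hj k hk => ?_⟩
    have key : ∀ k, ¬ IsTreeBar U (G (seqPrefix (fun i => m (j i)) k)) := by
      intro k
      induction k with
      | zero => simpa [G, seqPrefix] using hF
      | succ k ih =>
        have := hmA j hj k
        rw [if_neg ih] at this
        rw [seqPrefix_succ]
        exact this
    exact key k ⟨fun _ => univ, fun _ => Filter.univ_mem, fun P _ => ⟨0, by
      simpa [G, seqPrefix] using hk⟩⟩

/-! ### Rosenthal's dichotomy. -/

/-- Rosenthal's dichotomy at a pair of levels, for a sequence of functions. -/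
theorem exists_independent_or_not_oscillating {X : Type*} (f : ℕ → X → ℝ) (a b : ℝ) :
    ∃ m : ℕ → ℕ, StrictMono m ∧
      ((∀ P M : Finset ℕ, Disjoint P M → ∃ x, (∀ n ∈ P, f (m n) x < a) ∧ ∀ n ∈ M, b < f (m n) x) ∨
        ∀ x, ¬ ((∃ᶠ n in Filter.atTop, f (m n) x < a) ∧ ∃ᶠ n in Filter.atTop, b < f (m n) x)) := by
  classical
  let alt : List ℕ → X → Prop := fun l x => ∀ i, i < l.length →
    (Even i → f (l.getD i 0) x < a) ∧ (¬ Even i → b < f (l.getD i 0) x)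
  have halt : ∀ P k x, alt (seqPrefix P k) x ↔ ∀ i < k,
      (Even i → f (P i) x < a) ∧ (¬ Even i → b < f (P i) x) := by
    intro P k x
    have hlen : (seqPrefix P k).length = k := by simp [seqPrefix]
    simp only [alt, hlen]
    refine forall₂_congr fun i hi => ?_
    have : (seqPrefix P k).getD i 0 = P i := by
      simp [seqPrefix, List.getD_eq_getElem?_getD, hi]
    rw [this]
  -- A point that oscillates along `m` alternates forever along some subsequence, so it is excluded
  -- if every subsequence has a prefix on which no point alternates. Otherwise all finite
  -- alternating patterns along all subsequences are realized.
  obtain ⟨m, hm, h | h⟩ := exists_strictMono_forall_prefix {l | ¬ ∃ x, alt l x}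
  · refine ⟨m, hm, Or.inr fun x ⟨h1, h2⟩ => ?_⟩
    obtain ⟨j, hj, hjx⟩ := Filter.extraction_forall_of_frequently
      (P := fun i n => (Even i → f (m n) x < a) ∧ (¬ Even i → b < f (m n) x)) (by
        intro i
        by_cases hi : Even i
        · exact h1.mono fun n hn => ⟨fun _ => hn, fun h => absurd hi h⟩
        · exact h2.mono fun n hn => ⟨fun h => absurd h hi, fun _ => hn⟩)
    obtain ⟨k, hk⟩ := h j hj
    exact hk ⟨x, (halt _ _ _).2 fun i _ => hjx i⟩
  -- From the block `3n, 3n+1, 3n+2` the sequence `j` takes the last two indices if `n ∈ P` and the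
  -- first two if not. Thus `3n+1` occupies an even position, where the value is below `a`, exactly
  -- when `n ∈ P`.
  · refine ⟨fun n => m (3 * n + 1), fun p q hpq => hm (by omega), Or.inl fun P M hPM => ?_⟩
    let j : ℕ → ℕ := fun i => 3 * (i / 2) + i % 2 + if i / 2 ∈ P then 1 else 0
    have hj : StrictMono j := by
      refine strictMono_nat_of_lt_succ fun n => ?_
      simp only [j]
      rcases Nat.even_or_odd' n with ⟨c, rfl | rfl⟩
      · have h1 : (2 * c + 1) / 2 = c := by omega
        have h2 : 2 * c / 2 = c := by omega
        rw [h1, h2]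
        split_ifs <;> omega
      · split_ifs <;> omega
    obtain ⟨N, hN⟩ : ∃ N, ∀ n ∈ P ∪ M, n < N := by
      obtain ⟨N, hN⟩ := (P ∪ M).exists_nat_subset_range
      exact ⟨N, fun n hn => Finset.mem_range.1 (hN hn)⟩
    obtain ⟨x, hx⟩ := not_not.1 (h j hj (2 * N))
    rw [halt] at hx
    refine ⟨x, fun n hn => ?_, fun n hn => ?_⟩
    · have := (hx (2 * n) (by have := hN n (Finset.mem_union_left _ hn); omega)).1 (by simp)
      have hjn : j (2 * n) = 3 * n + 1 := by
        have h2 : 2 * n / 2 = n := by omega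
        simp only [j, h2, if_pos hn]; omega
      rwa [hjn] at this
    · have := (hx (2 * n + 1) (by have := hN n (Finset.mem_union_right _ hn); omega)).2 (by simp)
      have hnP : n ∉ P := fun h => Finset.disjoint_left.1 hPM h hn
      have hjn : j (2 * n + 1) = 3 * n + 1 := by
        have h2 : (2 * n + 1) / 2 = n := by omega
        simp only [j, h2, if_neg hnP]; omega
      rwa [hjn] at this

theorem IsIndependentSeq.of_finset {X : Type*} {f : ℕ → X → ℝ} {a b : ℝ} (hab : a < b)
    (h : ∀ P M : Finset ℕ, Disjoint P M → ∃ x, (∀ n ∈ P, f n x < a) ∧ ∀ n ∈ M, b < f n x) :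
    IsIndependentSeq f :=
  ⟨a, b, hab, fun P M hPM => by
    obtain ⟨x, h1, h2⟩ := h P M hPM
    exact ⟨x, by simpa using h1, by simpa using h2⟩⟩

/-- Rosenthal's dichotomy at a pair of levels, for an infinite family of functions. -/
theorem Set.Infinite.exists_independent_or_not_oscillating {ι X : Type*} {L : Set ι}
    (hL : L.Infinite) (f : ι → X → ℝ) {a b : ℝ} (hab : a < b) :
    (∃ g : ℕ → ι, (∀ n, g n ∈ L) ∧ IsIndependentSeq fun n => f (g n)) ∨
      ∃ K ⊆ L, K.Infinite ∧
        ∀ x, ¬ ({s ∈ K | f s x < a}.Infinite ∧ {s ∈ K | b < f s x}.Infinite) := by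
  let e := Set.Infinite.natEmbedding L hL
  obtain ⟨m, hm, h | h⟩ :=
    _root_.exists_independent_or_not_oscillating (fun n => f (e n)) a b
  · exact Or.inl ⟨fun n => e (m n), fun n => (e (m n)).2, IsIndependentSeq.of_finset hab h⟩
  · have hinj : Function.Injective fun n => (e (m n) : ι) := fun p q hpq =>
      hm.injective (e.injective (Subtype.ext hpq))
    refine Or.inr ⟨range fun n => (e (m n) : ι), ?_, infinite_range_of_injective hinj, ?_⟩
    · rintro _ ⟨n, rfl⟩
      exact (e (m n)).2
    · intro x ⟨h1, h2⟩
      refine h x ⟨?_, ?_⟩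
      · rw [Nat.frequently_atTop_iff_infinite]
        refine fun hf => h1 ((hf.image fun n => (e (m n) : ι)).subset ?_)
        rintro _ ⟨⟨n, rfl⟩, hn⟩
        exact ⟨n, hn, rfl⟩
      · rw [Nat.frequently_atTop_iff_infinite]
        refine fun hf => h2 ((hf.image fun n => (e (m n) : ι)).subset ?_)
        rintro _ ⟨⟨n, rfl⟩, hn⟩
        exact ⟨n, hn, rfl⟩

/-- Finitely many hereditary properties, each satisfied by a subset of every infinite set, are
simultaneously satisfied by a subset of every infinite set. -/
theorem Set.Infinite.exists_subset_forall_mem_finset {ι τ : Type*} (Q : τ → Set ι → Prop)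
    (hQ : ∀ t K K', K' ⊆ K → Q t K → Q t K') (T : Finset τ)
    (h : ∀ t ∈ T, ∀ L : Set ι, L.Infinite → ∃ K ⊆ L, K.Infinite ∧ Q t K) {L : Set ι}
    (hL : L.Infinite) : ∃ K ⊆ L, K.Infinite ∧ ∀ t ∈ T, Q t K := by
  classical
  induction T using Finset.induction_on with
  | empty => exact ⟨L, Subset.rfl, hL, by simp⟩
  | insert t T ht ih =>
    obtain ⟨K, hKL, hK, hKQ⟩ := ih fun s hs => h s (Finset.mem_insert_of_mem hs)
    obtain ⟨K', hK'K, hK', hK'Q⟩ := h t (Finset.mem_insert_self _ _) K hK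
    refine ⟨K', hK'K.trans hKL, hK', fun s hs => ?_⟩
    rcases Finset.mem_insert.1 hs with rfl | hs
    · exact hK'Q
    · exact hQ _ _ _ hK'K (hKQ s hs)

/-! ## Subshifts whose coordinates are eventually constant along infinite sets -/

theorem Set.Infinite.exists_infinite_fiber {ι A : Type*} [Finite A] {K : Set ι}
    (hK : K.Infinite) (x : ι → A) : ∃ c, {s ∈ K | x s = c}.Infinite := by
  by_contra! h
  refine hK ((Set.finite_iUnion fun c => h c).subset fun s hs => ?_)
  exact mem_iUnion.2 ⟨x s, hs, rfl⟩

/-- The functions on a countable set which take a given value off a finite set are countably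
many. -/
theorem Set.countable_setOf_eventually_const {ι A : Type*} [Countable ι] [Countable A] :
    {y : ι → A | ∃ c, {i | y i ≠ c}.Finite}.Countable := by
  classical
  have h : {y : ι → A | ∃ c, {i | y i ≠ c}.Finite} = ⋃ c, {y : ι → A | {i | y i ≠ c}.Finite} := by
    ext y; simp
  rw [h]
  refine countable_iUnion fun c => ?_
  -- A function equal to `c` off a finite set is encoded by the finite part of its graph that avoids
  -- the value `c`.
  refine Set.MapsTo.countable_of_injOn (f := fun y : ι → A => {p : ι × A | y p.1 = p.2 ∧ p.2 ≠ c})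
    (t := {t : Set (ι × A) | t.Finite ∧ t ⊆ univ}) ?_ ?_
    (Set.countable_ofPred_finite_subset countable_univ)
  · intro y hy
    refine ⟨(Set.Finite.image (fun i => (i, y i)) hy).subset ?_, subset_univ _⟩
    rintro ⟨i, a⟩ ⟨h1, h2⟩
    simp only at h1 h2
    subst h1
    exact ⟨i, h2, rfl⟩
  · intro y _ z _ hyz
    simp only [Set.ext_iff, mem_ofPred_eq, Prod.forall] at hyz
    funext i
    by_cases hy : y i = c
    · by_cases hz : z i = c
      · rw [hy, hz]
      · have := (hyz i (z i)).2 ⟨rfl, hz⟩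
        exact this.1
    · exact ((hyz i (y i)).1 ⟨rfl, hy⟩).1.symm

/-- On a compact space, finitely many relatively open sets suffice to separate, in the manner
prescribed by a relation `R`, all pairs in a closed relation. -/
theorem exists_finset_forall_pair {X τ : Type*} [TopologicalSpace X] [CompactSpace X]
    {D : Set (X × X)} (hD : IsClosed D) (R : τ → X × X → Prop) (hR : ∀ t, IsOpen {p | R t p})
    (h : ∀ p ∈ D, ∃ t, R t p) : ∃ T : Finset τ, ∀ p ∈ D, ∃ t ∈ T, R t p := by
  obtain ⟨T, hT⟩ := hD.isCompact.elim_finite_subcover (fun t => {p | R t p}) hR fun p hp =>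
    mem_iUnion.2 (h p hp)
  exact ⟨T, fun p hp => by simpa using hT hp⟩

namespace Subshift

variable {S : Type u} {A : Type v} [Monoid S] [TopologicalSpace A]

instance (X : Subshift S A) [Finite A] : CompactSpace X.Points :=
  isCompact_iff_compactSpace.1 X.isClosed.isCompact

/-- Every infinite set of coordinates has an infinite subset along which no point of `X` takes two
values infinitely often. -/
def IsNonOscillating (X : Subshift S A) : Prop :=
  ∀ L : Set S, L.Infinite → ∃ K ⊆ L, K.Infinite ∧
    ∀ x ∈ X.carrier, ∃ c, {s ∈ K | x s ≠ c}.Finite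

theorem isNonOscillating_of_pairwise [Finite A] {X : Subshift S A}
    (h : ∀ L : Set S, L.Infinite → ∃ K ⊆ L, K.Infinite ∧ ∀ x ∈ X.carrier, ∀ c d, c ≠ d →
      ¬ ({s ∈ K | x s = c}.Infinite ∧ {s ∈ K | x s = d}.Infinite)) :
    X.IsNonOscillating := by
  intro L hL
  obtain ⟨K, hKL, hK, hx⟩ := h L hL
  refine ⟨K, hKL, hK, fun x hxX => ?_⟩
  obtain ⟨c, hc⟩ := Set.Infinite.exists_infinite_fiber hK x
  refine ⟨c, ?_⟩
  have : {s ∈ K | x s ≠ c} = ⋃ d : {d // d ≠ c}, {s ∈ K | x s = d} := by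
    ext s; simp
  rw [this]
  refine Set.finite_iUnion fun d => Set.not_infinite.1 fun hd => hx x hxX c d d.2.symm ⟨hc, hd⟩

/-- The indicator function of the set of points whose value at a given coordinate lies in a given
set. -/
noncomputable def coordIndicator [DiscreteTopology A] (X : Subshift S A) (s : S) (P : Set A) :
    C(X.Points, ℝ) :=
  open scoped Classical in
  ⟨fun x => if x.1 s ∈ P then 1 else 0,
    (continuous_of_discreteTopology (f := fun a : A => if a ∈ P then (1 : ℝ) else 0)).comp
      ((continuous_apply s).comp continuous_subtype_val)⟩

open scoped Classical in
theorem coordIndicator_apply [DiscreteTopology A] (X : Subshift S A) (s : S) (P : Set A)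
    (x : X.Points) : X.coordIndicator s P x = if x.1 s ∈ P then 1 else 0 := rfl

theorem coordIndicator_smul [DiscreteTopology A] (X : Subshift S A) (s t : S) (P : Set A)
    (x : X.Points) : X.coordIndicator s P (t • x) = X.coordIndicator (s * t) P x := rfl

/-- The indicators of a letter at the various coordinates lie in the orbit of its indicator at `1`,
so tameness leaves only the second alternative of the dichotomy. The finitely many letters are
treated in succession. -/
theorem isNonOscillating_of_isTame [Finite A] [DiscreteTopology A] {X : Subshift S A}
    (h : IsTameSystem S X.Points) : X.IsNonOscillating := by
  cases nonempty_fintype A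
  refine isNonOscillating_of_pairwise fun L hL => ?_
  obtain ⟨K, hKL, hK, hQ⟩ := hL.exists_subset_forall_mem_finset
    (fun (c : A) (K : Set S) => ∀ x ∈ X.carrier,
      ¬ ({s ∈ K | x s = c}.Infinite ∧ {s ∈ K | x s ≠ c}.Infinite))
    (fun c K K' hKK' hK x hx hx' => hK x hx
      ⟨hx'.1.mono fun s hs => ⟨hKK' hs.1, hs.2⟩, hx'.2.mono fun s hs => ⟨hKK' hs.1, hs.2⟩⟩)
    Finset.univ (by
      intro c _ L hL
      rcases hL.exists_independent_or_not_oscillating (fun s => ⇑(X.coordIndicator s {c}))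
        (show (1 / 3 : ℝ) < 2 / 3 by norm_num) with ⟨g, -, hg⟩ | ⟨K, hKL, hK, hx⟩
      · refine absurd hg (h (X.coordIndicator 1 {c}) _ fun n => ⟨g n, ?_⟩)
        funext x
        exact (X.coordIndicator_smul 1 (g n) {c} x).trans (by rw [one_mul])
      · refine ⟨K, hKL, hK, fun x hxX hx' => hx ⟨x, hxX⟩ ⟨?_, ?_⟩⟩
        · refine hx'.2.mono fun s hs => ⟨hs.1, ?_⟩
          rw [coordIndicator_apply, if_neg (show x s ∉ ({c} : Set A) from hs.2)]; norm_num
        · refine hx'.1.mono fun s hs => ⟨hs.1, ?_⟩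
          rw [coordIndicator_apply, if_pos (show x s ∈ ({c} : Set A) from hs.2)]; norm_num)
  exact ⟨K, hKL, hK, fun x hx c d hcd hcd' => hQ c (Finset.mem_univ c) x hx
    ⟨hcd'.1, hcd'.2.mono fun s hs => ⟨hs.1, fun h => hcd (h.symm.trans hs.2)⟩⟩⟩

/-- `L` is first thinned to a countable set, because the count of eventually constant words needs a
countable index set. -/
theorem IsNonOscillating.exists_countable [Finite A] {X : Subshift S A} (h : X.IsNonOscillating)
    (L : Set S) (hL : L.Infinite) :
    ∃ K ⊆ L, K.Infinite ∧ (K.domRestrict '' X.carrier).Countable := by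
  let e := Set.Infinite.natEmbedding L hL
  let L' : Set S := range fun n => (e n : S)
  have hL' : L'.Infinite :=
    infinite_range_of_injective (Subtype.val_injective.comp e.injective)
  obtain ⟨K, hKL, hK, hx⟩ := h L' hL'
  have hKc : Countable K := ((countable_range _).mono hKL).to_subtype
  refine ⟨K, hKL.trans ?_, hK, Set.countable_setOf_eventually_const.mono ?_⟩
  · rintro _ ⟨n, rfl⟩
    exact (e n).2
  · rintro _ ⟨x, hxX, rfl⟩
    obtain ⟨c, hc⟩ := hx x hxX
    exact ⟨c, Set.Finite.of_finite_image (hc.subset (by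
      rintro _ ⟨i, hi, rfl⟩
      exact ⟨i.2, hi⟩)) Subtype.val_injective.injOn⟩

theorem exists_subset_countable_restrict_iff (X : Subshift S A) (K : Set S) :
    (∃ Y ⊆ X.carrier, Y.Countable ∧ K.domRestrict '' X.carrier = K.domRestrict '' Y) ↔
      (K.domRestrict '' X.carrier).Countable := by
  constructor
  · rintro ⟨Y, -, hY, h⟩
    rw [h]
    exact hY.image _
  · intro h
    obtain ⟨Y, hYX, hYK⟩ := Set.exists_subset_bijOn X.carrier K.domRestrict
    exact ⟨Y, hYX, hYK.mapsTo.countable_of_injOn hYK.injOn h, hYK.image_eq.symm⟩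

/-- A cardinality argument: independence and compactness provide a point for each subset of `ℕ`,
whereas countable restrictions leave only countably many patterns to distinguish these points. -/
theorem isTame_of_exists_countable [Finite A] [DiscreteTopology A] {X : Subshift S A}
    (h : ∀ L : Set S, L.Infinite → ∃ K ⊆ L, K.Infinite ∧
      (K.domRestrict '' X.carrier).Countable) : IsTameSystem S X.Points := by
  classical
  rintro f g hg ⟨a, b, hab, hind⟩
  choose s hs using hg
  -- all patterns are realized, by compactness
  have hpat : ∀ P : Set ℕ, ∃ x : X.Points, ∀ n, (n ∈ P → g n x ≤ a) ∧ (n ∉ P → b ≤ g n x) := by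
    intro P
    have hgc : ∀ n, Continuous (g n) := fun n => by
      rw [← hs n]
      exact f.continuous.comp (continuous_const_smul (s n))
    have := isCompact_univ.inter_iInter_nonempty (X := X.Points)
      (fun n => {x | (n ∈ P → g n x ≤ a) ∧ (n ∉ P → b ≤ g n x)}) (by
        intro n
        by_cases hn : n ∈ P
        · simpa [hn] using isClosed_le (hgc n) continuous_const
        · simpa [hn] using isClosed_le continuous_const (hgc n)) (by
        intro T
        obtain ⟨x, hx1, hx2⟩ := hind (T.filter (· ∈ P)) (T.filter (· ∉ P))
          (Finset.disjoint_filter_filter_not _ _ _)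
        refine ⟨x, mem_univ _, ?_⟩
        simp only [mem_iInter, Finset.mem_filter, mem_preimage, mem_Iio, mem_Ioi, and_imp,
          mem_ofPred_eq] at hx1 hx2 ⊢
        exact fun n hn => ⟨fun h => (hx1 n hn h).le, fun h => (hx2 n hn h).le⟩)
    obtain ⟨x, -, hx⟩ := this
    exact ⟨x, by simpa using hx⟩
  -- `f` is determined up to `b - a` by finitely many coordinates
  obtain ⟨T, hT⟩ := exists_finset_forall_pair (X := X.Points) (τ := S)
    (D := {p | b - a ≤ |f p.1 - f p.2|})
    (isClosed_le continuous_const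
      ((f.continuous.comp continuous_fst).sub (f.continuous.comp continuous_snd)).abs)
    (fun t p => p.1.1 t ≠ p.2.1 t)
    (fun t => isOpen_ne_fun
      ((continuous_apply t).comp (continuous_subtype_val.comp continuous_fst))
      ((continuous_apply t).comp (continuous_subtype_val.comp continuous_snd)))
    (by
      rintro ⟨x, y⟩ hxy
      by_contra! hcon
      have : x = y := Subtype.ext (funext hcon)
      simp only [this, mem_ofPred_eq, sub_self, abs_zero] at hxy
      linarith)
  -- pass to an infinite set of indices with countably many patterns
  obtain ⟨N, -, hN, hNT⟩ := (infinite_univ (α := ℕ)).exists_subset_forall_mem_finset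
    (fun (t : S) (N : Set ℕ) =>
      (range fun (x : X.Points) (n : N) => x.1 (t * s n)).Countable)
    (by
      intro t N N' hN hc
      refine (hc.image fun y (n : N') => y ⟨n, hN n.2⟩).mono ?_
      rintro _ ⟨x, rfl⟩
      exact ⟨_, ⟨x, rfl⟩, rfl⟩)
    T (by
      intro t _ N hN
      obtain ⟨K, hK, hKc⟩ : ∃ K : Set S, {n ∈ N | t * s n ∈ K}.Infinite ∧
          (K.domRestrict '' X.carrier).Countable := by
        -- The products `t * s n` may take only finitely many values. Then they themselves serve as
        -- `K`, as a finite alphabet has finitely many words on a finite set.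
        by_cases hfin : ((fun n => t * s n) '' N).Finite
        · refine ⟨(fun n => t * s n) '' N, ?_, ?_⟩
          · convert hN using 1
            ext n
            exact ⟨fun h => h.1, fun h => ⟨h, n, h, rfl⟩⟩
          · have := hfin.to_subtype
            exact (Set.toFinite _).countable
        · obtain ⟨K, hKL, hK, hKc⟩ := h _ hfin
          refine ⟨K, fun hf => hK ((hf.image fun n => t * s n).subset ?_), hKc⟩
          intro k hk
          obtain ⟨n, hn, rfl⟩ := hKL hk
          exact ⟨n, ⟨hn, hk⟩, rfl⟩
      refine ⟨_, fun n hn => hn.1, hK, ?_⟩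
      refine (hKc.image fun y (n : {n ∈ N | t * s n ∈ K}) => y ⟨t * s n, n.2.2⟩).mono ?_
      rintro _ ⟨x, rfl⟩
      exact ⟨_, ⟨x.1, x.2, rfl⟩, rfl⟩)
  -- but the patterns on `N` encode all subsets of `N`
  have hcount : (range fun (x : X.Points) (t : T) (n : N) => x.1 (t * s n)).Countable := by
    refine (Set.countable_pi (s := fun t : T => range fun (x : X.Points) (n : N) => x.1 (t * s n))
      fun t => hNT t t.2).mono ?_
    rintro _ ⟨x, rfl⟩ t
    exact ⟨x, rfl⟩
  choose x hx using fun P : Set N => hpat (Subtype.val '' P)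
  have hinj : Function.Injective fun (P : Set N) (t : T) (n : N) => (x P).1 (t * s n) := by
    intro P Q hPQ
    have hclose : ∀ n : N, |g n (x P) - g n (x Q)| < b - a := by
      intro n
      by_contra! hcon
      rw [← hs n] at hcon
      obtain ⟨t, ht, hne⟩ := hT (s n • x P, s n • x Q) hcon
      exact hne (congrFun (congrFun hPQ ⟨t, ht⟩) n)
    have hmem : ∀ (P : Set N) (n : N), (n : ℕ) ∈ Subtype.val '' P ↔ n ∈ P := fun P n =>
      Subtype.val_injective.mem_set_image
    ext n
    have h1 := hx P n
    have h2 := hx Q n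
    have h3 := abs_lt.1 (hclose n)
    rw [hmem] at h1 h2
    by_cases hP : n ∈ P <;> by_cases hQ : n ∈ Q <;> simp only [hP, hQ, not_true_eq_false,
      not_false_eq_true, true_imp_iff, false_imp_iff, true_and, and_true] at h1 h2 ⊢ <;> linarith
  have : Countable (Set N) := by
    have h1 := hcount.mono (s₁ := range fun (P : Set N) (t : T) (n : N) => (x P).1 (t * s n)) (by
      rintro _ ⟨P, rfl⟩
      exact ⟨x P, rfl⟩)
    have := h1.to_subtype
    exact (Equiv.ofInjective _ hinj).injective.countable
  have := hN.to_subtype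
  exact (Cardinal.cantor Cardinal.aleph0).not_ge (by
    have h1 : Cardinal.mk (Set N) ≤ Cardinal.aleph0 := Cardinal.mk_le_aleph0
    rw [Cardinal.mk_set] at h1
    exact (Cardinal.power_le_power_left two_ne_zero (Cardinal.aleph0_le_mk N)).trans h1)

end Subshift

/-! ## Sequences equivalent to the basis of `ℓ¹` -/

theorem exists_weights_of_mem_convexHull_range {E ι : Type*} [AddCommGroup E] [Module ℝ E]
    {c : ι → E} {w : E} (hw : w ∈ convexHull ℝ (range c)) :
    ∃ (s : Finset ι) (u : ι → ℝ), (∀ i ∈ s, 0 ≤ u i) ∧ ∑ i ∈ s, u i = 1 ∧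
      w = ∑ i ∈ s, u i • c i := by
  rw [convexHull_range_eq_exists_affineCombination] at hw
  obtain ⟨s, u, hu, hu1, rfl⟩ := hw
  exact ⟨s, u, hu, hu1, s.affineCombination_eq_linear_combination _ _ hu1⟩

/-- If all convex combinations of a family have norm at least `δ` then some functional of norm at
most one is at least `δ` on the family. -/
theorem exists_dual_ge_of_forall_convex_combination {E ι : Type*} [NormedAddCommGroup E]
    [NormedSpace ℝ E] {c : ι → E} {δ : ℝ} (hδ : 0 < δ)
    (h : ∀ (s : Finset ι) (u : ι → ℝ), (∀ i ∈ s, 0 ≤ u i) → ∑ i ∈ s, u i = 1 →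
      δ ≤ ‖∑ i ∈ s, u i • c i‖) :
    ∃ φ : E →L[ℝ] ℝ, (∀ f, |φ f| ≤ ‖f‖) ∧ ∀ i, δ ≤ φ (c i) := by
  obtain ⟨f, r, hf, hr⟩ := geometric_hahn_banach_open (convex_ball (0 : E) δ) Metric.isOpen_ball
    (convex_convexHull ℝ (range c)) (by
      rw [Set.disjoint_left]
      intro w hw hw'
      obtain ⟨s, u, hu, hu1, rfl⟩ := exists_weights_of_mem_convexHull_range hw'
      rw [mem_ball_zero_iff] at hw
      exact absurd (h s u hu hu1) hw.not_ge)
  have hr0 : 0 < r := by simpa using hf 0 (by simpa using hδ)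
  have hle : ∀ x, (δ / r) * f x ≤ ‖x‖ := by
    intro x
    by_contra! hx
    have hp : 0 < (δ / r) * f x := (norm_nonneg x).trans_lt hx
    -- If the bound failed, the multiple of `x` at which `f` equals `r` would lie in the open ball
    -- of radius `δ`, where `f < r`.
    have hm := hf ((δ / ((δ / r) * f x)) • x) (by
      rw [mem_ball_zero_iff, norm_smul, Real.norm_of_nonneg (by positivity), div_mul_eq_mul_div,
        div_lt_iff₀ hp]
      gcongr)
    rw [map_smul, smul_eq_mul] at hm
    have hfx : f x ≠ 0 := by
      rintro h0
      simp [h0] at hp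
    have : δ / (δ / r * f x) * f x = r := by field_simp
    exact hm.ne this
  refine ⟨(δ / r) • f, fun x => ?_, fun i => ?_⟩
  · rw [abs_le]
    have := hle (-x)
    rw [map_neg, norm_neg] at this
    exact ⟨by simp only [_root_.smul_apply, smul_eq_mul]; linarith,
      by simpa using hle x⟩
  · have := hr (c i) (subset_convexHull ℝ _ ⟨i, rfl⟩)
    calc δ = δ / r * r := by field_simp
      _ ≤ δ / r * f (c i) := by gcongr

/-- The sequence `v` satisfies the lower `ℓ¹`-estimate with constant `δ`. -/
def HasLowerL1Estimate {E : Type*} [NormedAddCommGroup E] [NormedSpace ℝ E] (δ : ℝ)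
    (v : ℕ → E) : Prop :=
  ∀ (s : Finset ℕ) (u : ℕ → ℝ), δ * ∑ i ∈ s, |u i| ≤ ‖∑ i ∈ s, u i • v i‖

/-- Changing the sign of `v i` for `i ∉ σ` preserves the lower estimate, which bounds all convex
combinations of the signed family from below by `δ`. -/
theorem HasLowerL1Estimate.exists_dual {E : Type*} [NormedAddCommGroup E] [NormedSpace ℝ E]
    {δ : ℝ} (hδ : 0 < δ) {v : ℕ → E} (hv : HasLowerL1Estimate δ v) (σ : Finset ℕ) :
    ∃ φ : E →L[ℝ] ℝ, (∀ f, |φ f| ≤ ‖f‖) ∧ ∀ i, (i ∈ σ → δ ≤ φ (v i)) ∧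
      (i ∉ σ → φ (v i) ≤ -δ) := by
  classical
  obtain ⟨φ, hφ, h⟩ := exists_dual_ge_of_forall_convex_combination
    (c := fun i => (if i ∈ σ then (1 : ℝ) else -1) • v i) hδ (by
      intro s u hu hu1
      have := hv s fun i => u i * if i ∈ σ then (1 : ℝ) else -1
      have habs : ∑ i ∈ s, |u i * if i ∈ σ then (1 : ℝ) else -1| = 1 := by
        refine Eq.trans (Finset.sum_congr rfl fun i hi => ?_) hu1
        by_cases hiσ : i ∈ σ <;> simp [hiσ, abs_of_nonneg (hu i hi)]
      rw [habs, mul_one] at this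
      refine this.trans (le_of_eq ?_)
      simp only [smul_smul])
  refine ⟨φ, hφ, fun i => ⟨fun hi => ?_, fun hi => ?_⟩⟩
  · simpa [hi] using h i
  · have := h i
    simp only [hi, if_false, neg_smul, one_smul, map_neg] at this
    linarith

/-! ### The averaged seminorm and total boundedness. -/

/-- A space with a sequence satisfying a lower `ℓ¹`-estimate carries a seminorm, a limit of
averages over all signs of functionals realizing these signs, for which the sequence is
separated. -/
theorem HasLowerL1Estimate.exists_seminorm {E : Type*} [NormedAddCommGroup E] [NormedSpace ℝ E]
    {δ : ℝ} (hδ : 0 < δ) {v : ℕ → E} (hv : HasLowerL1Estimate δ v) :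
    ∃ p : Seminorm ℝ E, (∀ f, p f ≤ ‖f‖) ∧ (∀ i j, i ≠ j → δ ≤ p (v i - v j)) ∧
      ∀ (g : ℕ → E) (s : Finset ℕ) (a : ℕ → ℝ) (r : ℝ), (∀ i ∈ s, 0 ≤ a i) →
        (∀ ε : ℕ → ℝ, (∀ i, |ε i| = 1) → ‖∑ i ∈ s, (a i * ε i) • g i‖ ≤ r) →
        ∑ i ∈ s, a i * p (g i) ≤ r := by
  classical
  choose φ hφ hφv using fun σ => hv.exists_dual hδ σ
  let q : ℕ → E → ℝ := fun N f => (2 ^ N)⁻¹ * ∑ σ ∈ (Finset.range N).powerset, |φ σ f|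
  have hcard : ∀ N : ℕ, ∑ _σ ∈ (Finset.range N).powerset, (1 : ℝ) = 2 ^ N := by
    intro N; simp
  have hq0 : ∀ N f, 0 ≤ q N f := fun N f =>
    mul_nonneg (by positivity) (Finset.sum_nonneg fun _ _ => abs_nonneg _)
  have havg : ∀ N (F : Finset ℕ → ℝ) (r : ℝ), (∀ σ, F σ ≤ r) →
      (2 ^ N)⁻¹ * ∑ σ ∈ (Finset.range N).powerset, F σ ≤ r := by
    intro N F r hF
    rw [inv_mul_le_iff₀ (by positivity), ← hcard N, Finset.sum_mul]
    exact Finset.sum_le_sum fun σ _ => by simpa using hF σ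
  have hqn : ∀ N f, q N f ≤ ‖f‖ := fun N f => havg N _ _ fun σ => hφ σ f
  let U : Ultrafilter ℕ := Filter.hyperfilter ℕ
  have hU : (U : Filter ℕ) ≤ Filter.atTop := by
    rw [← Nat.cofinite_eq_atTop]; exact Filter.hyperfilter_le_cofinite
  have hlim : ∀ f, ∃ r, Filter.Tendsto (fun N => q N f) U (𝓝 r) := by
    intro f
    obtain ⟨r, -, hr⟩ := (isCompact_Icc (a := (0 : ℝ)) (b := ‖f‖)).ultrafilter_le_nhds
      (U.map fun N => q N f) (by
        rw [Filter.le_principal_iff]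
        exact Filter.mem_map.2 (Filter.univ_mem' fun N => ⟨hq0 N f, hqn N f⟩))
    exact ⟨r, hr⟩
  choose p hp using hlim
  have hpadd : ∀ f g, p (f + g) ≤ p f + p g := by
    intro f g
    refine le_of_tendsto_of_tendsto' (hp _) ((hp f).add (hp g)) fun N => ?_
    simp only [q]
    rw [← mul_add, ← Finset.sum_add_distrib]
    gcongr with σ
    rw [map_add]
    exact abs_add_le _ _
  have hpsmul : ∀ (c : ℝ) f, p (c • f) = ‖c‖ * p f := by
    intro c f
    refine tendsto_nhds_unique (hp _) (((hp f).const_mul ‖c‖).congr fun N => ?_)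
    simp only [q, map_smul, smul_eq_mul, abs_mul, ← Finset.mul_sum, Real.norm_eq_abs]
    ring
  refine ⟨Seminorm.of p hpadd hpsmul, fun f => le_of_tendsto' (hp f) fun N => hqn N f, ?_, ?_⟩
  · intro i j hij
    refine ge_of_tendsto (hp (v i - v j)) (hU ?_)
    filter_upwards [Filter.eventually_gt_atTop i] with N hN
    have hins : Finset.range N = insert i ((Finset.range N).erase i) :=
      (Finset.insert_erase (Finset.mem_range.2 hN)).symm
    -- If `σ` and `τ` differ at `i` and agree at `j`, one of the two functionals has opposite signs
    -- on `v i` and `v j`, hence a gap of at least `2δ`. Pairing each `σ` with `insert i σ` makes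
    -- the average at least `δ`.
    have hlow : ∀ σ τ : Finset ℕ, i ∉ σ → i ∈ τ → (j ∈ σ ↔ j ∈ τ) →
        2 * δ ≤ |φ σ (v i - v j)| + |φ τ (v i - v j)| := by
      intro σ τ hσ hτ hj
      have h1 := (hφv σ i).2 hσ
      have h2 := (hφv τ i).1 hτ
      rw [map_sub, map_sub]
      by_cases hjσ : j ∈ σ
      · have h3 := (hφv σ j).1 hjσ
        have h4 := neg_abs_le (φ σ (v i) - φ σ (v j))
        have h5 := abs_nonneg (φ τ (v i) - φ τ (v j))
        linarith
      · have h3 := (hφv τ j).2 (mt hj.2 hjσ)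
        have h4 := le_abs_self (φ τ (v i) - φ τ (v j))
        have h5 := abs_nonneg (φ σ (v i) - φ σ (v j))
        linarith
    have h2 : (2 : ℝ) ^ N = 2 * ∑ _σ ∈ ((Finset.range N).erase i).powerset, (1 : ℝ) := by
      rw [← hcard N]
      conv_lhs => rw [hins]
      rw [Finset.sum_powerset_insert (Finset.notMem_erase _ _), two_mul]
    simp only [q]
    rw [le_inv_mul_iff₀ (by positivity), h2]
    conv_rhs => rw [hins]
    rw [Finset.sum_powerset_insert (Finset.notMem_erase _ _), ← Finset.sum_add_distrib,
      mul_right_comm, Finset.mul_sum]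
    refine Finset.sum_le_sum fun σ hσ => ?_
    rw [mul_one]
    refine hlow σ (insert i σ) (fun h => ?_) (Finset.mem_insert_self _ _)
      ⟨Finset.mem_insert_of_mem, fun h => (Finset.mem_insert.1 h).resolve_left hij.symm⟩
    exact Finset.notMem_erase i _ (Finset.mem_powerset.1 hσ h)
  · intro g s a r ha hr
    refine le_of_tendsto' (tendsto_finsetSum s fun i _ => (hp (g i)).const_mul (a i)) fun N => ?_
    have : ∑ i ∈ s, a i * q N (g i) =
        (2 ^ N)⁻¹ * ∑ σ ∈ (Finset.range N).powerset, ∑ i ∈ s, a i * |φ σ (g i)| := by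
      simp only [q, Finset.mul_sum]
      rw [Finset.sum_comm]
      refine Finset.sum_congr rfl fun σ _ => Finset.sum_congr rfl fun i _ => by ring
    rw [this]
    refine havg N _ _ fun σ => ?_
    -- The signs `ε` are chosen as those of `φ σ (g i)`, so that the weighted sum of absolute values
    -- is `φ σ` of a single signed sum.
    refine le_trans (le_trans (le_of_eq ?_) ((le_abs_self _).trans (hφ σ _)))
      (hr (fun i => if 0 ≤ φ σ (g i) then 1 else -1) fun i => by split_ifs <;> simp)
    rw [map_sum]
    refine Finset.sum_congr rfl fun i _ => ?_
    rw [map_smul, smul_eq_mul, mul_assoc]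
    split_ifs with h
    · rw [one_mul, abs_of_nonneg h]
    · rw [neg_one_mul, abs_of_neg (not_le.1 h)]

/-- If no sequence in `F` is separated for the seminorm `p` then no sequence in the absolutely
convex hull of `F` is. -/
theorem Seminorm.exists_lt_of_absConvexHull {E : Type*} [AddCommGroup E] [Module ℝ E]
    (p : Seminorm ℝ E) {F : Set E}
    (hF : ∀ f : ℕ → E, (∀ n, f n ∈ F) → ∀ ε > 0, ∃ m n, m < n ∧ p (f m - f n) < ε)
    {w : ℕ → E} (hw : ∀ n, w n ∈ absConvexHull ℝ F) {ε : ℝ} (hε : 0 < ε) :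
    ∃ m n, m ≠ n ∧ p (w m - w n) < ε := by
  classical
  -- With `p` as seminorm of the space, the hypothesis is total boundedness of `F`, which the
  -- absolutely convex hull inherits.
  let : Norm E := ⟨p⟩
  have core : SeminormedSpace.Core ℝ E :=
    { norm_nonneg := fun x => apply_nonneg p x
      norm_smul := fun c x => map_smul_eq_mul p c x
      norm_triangle := fun x y => map_add_le_add p x y }
  let : SeminormedAddCommGroup E := SeminormedAddCommGroup.ofCore core
  let : NormedSpace ℝ E := { norm_smul_le := fun c x => (map_smul_eq_mul p c x).le }
  have hdist : ∀ x y : E, dist x y = p (x - y) := fun x y => dist_eq_norm x y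
  have hTB : TotallyBounded F := by
    rw [Metric.totallyBounded_iff]
    intro η hη
    by_contra! hcon
    obtain ⟨f, hf, hfs⟩ := exists_seq_of_forall_finset_exists (fun y => y ∈ F)
      (fun x y => η ≤ p (x - y)) (by
        intro s _
        have := hcon s s.finite_toSet
        obtain ⟨y, hy, hys⟩ := Set.not_subset.1 this
        refine ⟨y, hy, fun x hx => ?_⟩
        by_contra! hlt
        refine hys (mem_iUnion₂.2 ⟨x, hx, ?_⟩)
        rwa [Metric.mem_ball, dist_comm, hdist])
    obtain ⟨m, n, hmn, hlt⟩ := hF f hf η hη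
    exact absurd (hfs m n hmn) hlt.not_ge
  have hTB' : TotallyBounded (absConvexHull ℝ F) := hTB.absConvexHull
  obtain ⟨t, ht, htw⟩ := Metric.totallyBounded_iff.1 hTB' (ε / 2) (half_pos hε)
  choose y hyt hy using fun n => mem_iUnion₂.1 (htw (hw n))
  have := ht.to_subtype
  obtain ⟨m, n, hmn, hymn⟩ := Finite.exists_ne_map_eq_of_infinite
    (fun n => (⟨y n, hyt n⟩ : t))
  refine ⟨m, n, hmn, ?_⟩
  have hymn' : y m = y n := congrArg Subtype.val hymn
  rw [← hdist]
  calc dist (w m) (w n) ≤ dist (w m) (y m) + dist (w n) (y m) := dist_triangle_right _ _ _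
    _ < ε / 2 + ε / 2 := add_lt_add (hy m) (by rw [hymn']; exact hy n)
    _ = ε := add_halves ε

/-! ### Uniformly small convex combinations in `C(X)`. -/

/-- A positive functional on `C(X)`, `X` compact Hausdorff, is continuous along bounded pointwise
convergent sequences. -/
theorem tendsto_of_positive_of_tendsto_pointwise {X : Type*} [TopologicalSpace X] [CompactSpace X]
    [T2Space X] (f : C(X, ℝ) →ₗ[ℝ] ℝ) (hf : ∀ h : C(X, ℝ), 0 ≤ h → 0 ≤ f h)
    {g : ℕ → C(X, ℝ)} {C : ℝ} (hC : ∀ n x, |g n x| ≤ C)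
    (hg : ∀ x, Filter.Tendsto (fun n => g n x) Filter.atTop (𝓝 0)) :
    Filter.Tendsto (fun n => f (g n)) Filter.atTop (𝓝 0) := by
  let : MeasurableSpace X := borel X
  have : BorelSpace X := ⟨rfl⟩
  let e := CompactlySupportedContinuousMap.continuousMapEquiv (α := X) (β := ℝ)
  let Λ₀ : CompactlySupportedContinuousMap X ℝ →ₗ[ℝ] ℝ :=
    { toFun := fun h => f h.toContinuousMap
      map_add' := fun h k => f.map_add h.toContinuousMap k.toContinuousMap
      map_smul' := fun c h => f.map_smul c h.toContinuousMap }
  let Λ := PositiveLinearMap.mk₀ Λ₀ fun h hh => hf h.toContinuousMap (show (0 : CompactlySupportedContinuousMap X ℝ).toContinuousMap ≤ _ from hh)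
  -- The Riesz–Markov measure of `f` is finite on the compact space, so the constant `C` is an
  -- integrable dominating function.
  have hΛ : ∀ h : C(X, ℝ), ∫ x, h x ∂(RealRMK.rieszMeasure Λ) = f h := fun h =>
    RealRMK.integral_rieszMeasure Λ (e h)
  have := MeasureTheory.tendsto_integral_of_dominated_convergence
    (μ := RealRMK.rieszMeasure Λ) (F := fun n x => g n x) (f := fun _ => 0) (fun _ => C)
    (fun n => (g n).continuous.aestronglyMeasurable) (MeasureTheory.integrable_const C)
    (fun n => Filter.Eventually.of_forall fun x => hC n x)
    (Filter.Eventually.of_forall hg)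
  simpa [hΛ] using this

/-- If a bounded sequence of nonnegative continuous functions on a compact Hausdorff space
converges pointwise to zero then it has convex combinations which are uniformly small. -/
theorem exists_convex_combination_le {X : Type*} [TopologicalSpace X] [CompactSpace X]
    [T2Space X] {g : ℕ → C(X, ℝ)} {C : ℝ} (hC : ∀ n x, |g n x| ≤ C)
    (hg : ∀ x, Filter.Tendsto (fun n => g n x) Filter.atTop (𝓝 0)) {ε : ℝ} (hε : 0 < ε) :
    ∃ (s : Finset ℕ) (u : ℕ → ℝ), (∀ i ∈ s, 0 ≤ u i) ∧ ∑ i ∈ s, u i = 1 ∧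
      ∀ x, ∑ i ∈ s, u i * g i x ≤ ε := by
  by_contra! hcon
  -- If no convex combination is at most `ε`, their hull misses the open convex set `O` of functions
  -- below `ε`. As `O` contains every nonpositive function, a separating functional is positive; its
  -- values on the `g n` stay above some `r > 0`, against their convergence to zero.
  let O : Set C(X, ℝ) := {f | MapsTo f univ (Iio ε)}
  have hO : ∀ f : C(X, ℝ), f ∈ O ↔ ∀ x, f x < ε := fun f =>
    ⟨fun h x => h (mem_univ x), fun h x _ => h x⟩
  have hOo : IsOpen O := ContinuousMap.isOpen_setOfPred_mapsTo isCompact_univ isOpen_Iio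
  have hOc : Convex ℝ O := by
    intro f hf h hh a b ha hb hab
    rw [hO] at *
    intro x
    exact convex_Iio ε (hf x) (hh x) ha hb hab
  obtain ⟨φ, r, hφ, hr⟩ := geometric_hahn_banach_open hOc hOo
    (convex_convexHull ℝ (range g)) (by
      rw [Set.disjoint_left]
      intro w hw hw'
      obtain ⟨s, u, hu, hu1, rfl⟩ := exists_weights_of_mem_convexHull_range hw'
      obtain ⟨x, hx⟩ := hcon s u hu hu1
      rw [hO] at hw
      have := hw x
      simp only [ContinuousMap.coe_sum, ContinuousMap.coe_smul, Finset.sum_apply, Pi.smul_apply,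
        smul_eq_mul] at this
      linarith)
  have hr0 : 0 < r := by simpa using hφ 0 ((hO 0).2 fun x => hε)
  have hpos : ∀ h : C(X, ℝ), 0 ≤ h → 0 ≤ φ h := by
    intro h hh
    by_contra! hneg
    have h1 := hφ ((r / φ h) • h) ((hO _).2 fun x => by
      have h2 : r / φ h ≤ 0 := div_nonpos_of_nonneg_of_nonpos hr0.le hneg.le
      have h3 : r / φ h * h x ≤ 0 := mul_nonpos_of_nonpos_of_nonneg h2 (hh x)
      exact lt_of_le_of_lt h3 hε)
    rw [map_smul, smul_eq_mul, div_mul_cancel₀ _ hneg.ne] at h1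
    exact lt_irrefl _ h1
  have hlim := tendsto_of_positive_of_tendsto_pointwise (φ : C(X, ℝ) →ₗ[ℝ] ℝ) hpos hC hg
  exact absurd (ge_of_tendsto' hlim fun n => hr (g n) (subset_convexHull ℝ _ ⟨n, rfl⟩))
    hr0.not_ge

/-- Let `F` be a bounded family of continuous functions in which every sequence has a subsequence
whose differences converge pointwise to zero. Then no sequence that can be approximated by
multiples of the absolutely convex hull of `F` satisfies a lower `ℓ¹`-estimate. -/
theorem not_hasLowerL1Estimate_of_approx {X : Type*} [TopologicalSpace X] [CompactSpace X]
    [T2Space X] {F : Set C(X, ℝ)} {C : ℝ} (hC : ∀ f ∈ F, ∀ x, |f x| ≤ C)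
    (hF : ∀ f : ℕ → C(X, ℝ), (∀ n, f n ∈ F) → ∃ k : ℕ → ℕ, StrictMono k ∧
      ∀ x, Filter.Tendsto (fun n => f (k n) x - f (k (n + 1)) x) Filter.atTop (𝓝 0))
    {v : ℕ → C(X, ℝ)}
    (hv : ∀ η > 0, ∃ M : ℝ, 0 < M ∧ ∀ i, ∃ w ∈ absConvexHull ℝ F, ‖v i - M • w‖ ≤ η)
    {δ : ℝ} (hδ : 0 < δ) : ¬ HasLowerL1Estimate δ v := by
  intro h
  obtain ⟨p, hpn, hpv, hps⟩ := h.exists_seminorm hδ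
  -- A convex combination of the functions `|d n|` is uniformly small, so all signed combinations
  -- with these weights are small in norm. The seminorm then makes the weighted mean of the `p (d
  -- n)` small, hence one of them.
  have hpF : ∀ f : ℕ → C(X, ℝ), (∀ n, f n ∈ F) → ∀ ε > 0, ∃ m n, m < n ∧ p (f m - f n) < ε := by
    intro f hf ε hε
    obtain ⟨k, hk, hkx⟩ := hF f hf
    let d : ℕ → C(X, ℝ) := fun n => f (k n) - f (k (n + 1))
    obtain ⟨s, u, hu, hu1, hsu⟩ := exists_convex_combination_le (g := fun n => |d n|)
      (C := C + C) (fun n x => by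
        simp only [ContinuousMap.abs_apply, abs_abs]
        exact (abs_sub _ _).trans (add_le_add (hC _ (hf _) x) (hC _ (hf _) x)))
      (fun x => by simpa [d] using (hkx x).abs) (half_pos hε)
    have hsum := hps d s u (ε / 2) hu (by
      intro θ hθ
      rw [ContinuousMap.norm_le _ (half_pos hε).le]
      intro x
      refine le_trans ?_ (hsu x)
      simp only [ContinuousMap.coe_sum, ContinuousMap.coe_smul, Finset.sum_apply, Pi.smul_apply,
        smul_eq_mul]
      refine (Finset.abs_sum_le_sum_abs _ _).trans (Finset.sum_le_sum fun i hi => ?_)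
      rw [abs_mul, abs_mul, hθ, mul_one, abs_of_nonneg (hu i hi)]
      rfl)
    by_contra! hcon
    have : ε ≤ ∑ i ∈ s, u i * p (d i) := by
      calc ε = ∑ i ∈ s, u i * ε := by rw [← Finset.sum_mul, hu1, one_mul]
        _ ≤ _ := Finset.sum_le_sum fun i hi =>
          mul_le_mul_of_nonneg_left (hcon _ _ (hk i.lt_succ_self)) (hu i hi)
    linarith
  -- Two approximation errors of `δ / 4` and a distance below `M * (δ / (2 * M))` add up to less
  -- than the separation `δ`.
  obtain ⟨M, hM, hMv⟩ := hv (δ / 4) (by positivity)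
  choose w hw hvw using hMv
  obtain ⟨m, n, hmn, hlt⟩ := p.exists_lt_of_absConvexHull hpF hw
    (show 0 < δ / (2 * M) by positivity)
  have h1 := hpv m n hmn
  have h2 : p (v m - v n) ≤ p (v m - M • w m) + M * p (w m - w n) + p (v n - M • w n) := by
    have e : v m - v n = (v m - M • w m) + M • (w m - w n) - (v n - M • w n) := by
      rw [smul_sub]; abel
    rw [e]
    refine (map_sub_le_add p _ _).trans ?_
    gcongr
    refine (map_add_le_add p _ _).trans ?_
    rw [map_smul_eq_mul, Real.norm_of_nonneg hM.le]
  have h3 : M * p (w m - w n) < δ / 2 := by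
    calc M * p (w m - w n) < M * (δ / (2 * M)) := by gcongr
      _ = δ / 2 := by field_simp
  have h4 := (hpn (v m - M • w m)).trans (hvw m)
  have h5 := (hpn (v n - M • w n)).trans (hvw n)
  linarith

/-! ### Lower estimates and copies of `ℓ¹`. -/

theorem HasLowerL1Estimate.isEmbedding_of_bound {V : Type*} [NormedAddCommGroup V]
    [NormedSpace ℝ V] [CompleteSpace V] {δ : ℝ} (hδ : 0 < δ) {v : ℕ → V}
    (hv : HasLowerL1Estimate δ v) {C : ℝ} (hC : ∀ n, ‖v n‖ ≤ C) :
    ∃ T : lp (fun _ : ℕ => ℝ) 1 →L[ℝ] V, IsEmbedding T := by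
  have hsum : ∀ u : lp (fun _ : ℕ => ℝ) 1, Summable fun i => |u i| := fun u => by
    simpa using (memℓp_gen_iff (p := 1) (by simp)).1 (lp.memℓp u)
  have hnorm : ∀ u : lp (fun _ : ℕ => ℝ) 1, ‖u‖ = ∑' i, |u i| := fun u => by
    simpa using lp.norm_eq_tsum_rpow (p := 1) (by simp) u
  have hle : ∀ (u : lp (fun _ : ℕ => ℝ) 1) i, ‖u i • v i‖ ≤ C * |u i| := fun u i => by
    rw [norm_smul, Real.norm_eq_abs, mul_comm]
    exact mul_le_mul_of_nonneg_right (hC i) (abs_nonneg _)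
  have hs : ∀ u : lp (fun _ : ℕ => ℝ) 1, Summable fun i => u i • v i := fun u =>
    Summable.of_norm_bounded ((hsum u).mul_left C) (hle u)
  let T₀ : lp (fun _ : ℕ => ℝ) 1 →ₗ[ℝ] V :=
    { toFun := fun u => ∑' i, u i • v i
      map_add' := fun u w => by
        rw [← (hs u).tsum_add (hs w)]
        exact tsum_congr fun i => add_smul _ _ _
      map_smul' := fun c u => by
        rw [RingHom.id_apply, ← (hs u).tsum_const_smul c]
        exact tsum_congr fun i => mul_smul c (u i) (v i) }
  have hT : ∀ u, ‖T₀ u‖ ≤ C * ‖u‖ := fun u => by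
    rw [hnorm, ← tsum_mul_left]
    exact tsum_of_norm_bounded ((hsum u).mul_left C).hasSum (hle u)
  let T := T₀.mkContinuous C hT
  have hlow : ∀ u, δ * ‖u‖ ≤ ‖T u‖ := fun u => by
    rw [hnorm]
    exact le_of_tendsto_of_tendsto' ((hsum u).hasSum.const_mul δ |> fun h => by
      simpa [HasSum, Finset.mul_sum] using h) (hs u).hasSum.norm fun s => hv s u
  refine ⟨T, (AntilipschitzWith.isUniformEmbedding (K := δ⁻¹.toNNReal) ?_
    T.uniformContinuous).isEmbedding⟩
  refine T.antilipschitz_of_bound fun u => ?_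
  rw [Real.coe_toNNReal _ (inv_pos.2 hδ).le, le_inv_mul_iff₀ hδ]
  exact hlow u

theorem exists_hasLowerL1Estimate_of_isEmbedding {V : Type*} [NormedAddCommGroup V]
    [NormedSpace ℝ V] (T : lp (fun _ : ℕ => ℝ) 1 →L[ℝ] V) (hT : IsEmbedding T) :
    ∃ (v : ℕ → V) (δ C : ℝ), 0 < δ ∧ HasLowerL1Estimate δ v ∧ ∀ n, ‖v n‖ ≤ C := by
  obtain ⟨K, hK⟩ := T.antilipschitz_of_isEmbedding hT
  have hK' : ∀ u, ‖u‖ ≤ K * ‖T u‖ := fun u => by simpa using hK.le_mul_dist u 0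
  -- The sequence is the image of the unit vectors; `K + 1` replaces `K`, which could be zero.
  refine ⟨fun n => T (lp.single 1 n 1), ((K : ℝ) + 1)⁻¹, ‖T‖, by positivity, ?_, ?_⟩
  · intro s u
    have h1 : ∑ i ∈ s, u i • T (lp.single 1 i (1 : ℝ)) = T (∑ i ∈ s, lp.single 1 i (u i)) := by
      rw [map_sum]
      refine Finset.sum_congr rfl fun i _ => ?_
      rw [← map_smul, ← lp.single_smul, smul_eq_mul, mul_one]
    have h2 : ∑ i ∈ s, |u i| = ‖∑ i ∈ s, lp.single (E := fun _ : ℕ => ℝ) 1 i (u i)‖ := by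
      have := lp.norm_sum_single (E := fun _ : ℕ => ℝ) (p := 1) (by simp) u s
      simpa using this.symm
    rw [h1, h2, inv_mul_le_iff₀ (by positivity)]
    refine (hK' _).trans ?_
    gcongr
    linarith
  · intro n
    refine (T.le_opNorm _).trans ?_
    rw [lp.norm_single (by simp)]
    simp

/-- Take `x` where the values are above `b` for `u i ≥ 0` and below `a` for `u i < 0`, and `y` the
other way round. Subtracting the two evaluations gives at least `(b - a) * ∑ |u i|`, while each is
bounded by `C` times the norm. -/
theorem IsIndependentSeq.hasLowerL1Estimate {V X : Type*} [NormedAddCommGroup V]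
    [NormedSpace ℝ V] {v : ℕ → V} {φ : X → V → ℝ} {C : ℝ}
    (hφ : ∀ x (s : Finset ℕ) (u : ℕ → ℝ), ∑ i ∈ s, u i * φ x (v i) ≤ C * ‖∑ i ∈ s, u i • v i‖)
    (h : IsIndependentSeq fun n x => φ x (v n)) : ∃ δ > 0, HasLowerL1Estimate δ v := by
  classical
  obtain ⟨a, b, hab, hind⟩ := h
  have hpos : 0 < 2 * (|C| + 1) := by positivity
  refine ⟨(b - a) / (2 * (|C| + 1)), div_pos (sub_pos.2 hab) hpos, fun s u => ?_⟩
  rw [div_mul_eq_mul_div, div_le_iff₀ hpos]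
  obtain ⟨x, hx1, hx2⟩ := hind (s.filter (u · < 0)) (s.filter fun i => ¬ u i < 0)
    (Finset.disjoint_filter_filter_not _ _ _)
  obtain ⟨y, hy1, hy2⟩ := hind (s.filter fun i => ¬ u i < 0) (s.filter (u · < 0))
    (Finset.disjoint_filter_filter_not _ _ _).symm
  simp only [mem_iInter, Finset.mem_filter, mem_preimage, mem_Iio, mem_Ioi, and_imp]
    at hx1 hx2 hy1 hy2
  have h1 := hφ x s u
  have h2 := hφ y s fun i => -u i
  have h3 : ‖∑ i ∈ s, (-u i) • v i‖ = ‖∑ i ∈ s, u i • v i‖ := by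
    simp [neg_smul]
  rw [h3] at h2
  have h4 : C * ‖∑ i ∈ s, u i • v i‖ ≤ (|C| + 1) * ‖∑ i ∈ s, u i • v i‖ := by
    gcongr
    linarith [le_abs_self C]
  have h5 : (b - a) * ∑ i ∈ s, |u i| ≤
      ∑ i ∈ s, u i * φ x (v i) + ∑ i ∈ s, -u i * φ y (v i) := by
    rw [Finset.mul_sum, ← Finset.sum_add_distrib]
    refine Finset.sum_le_sum fun i hi => ?_
    by_cases hu : u i < 0
    · have e1 := hx1 i hi hu
      have e2 := hy2 i hi hu
      rw [abs_of_neg hu]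
      nlinarith
    · have e1 := hx2 i hi hu
      have e2 := hy1 i hi hu
      rw [abs_of_nonneg (not_lt.1 hu)]
      nlinarith
  nlinarith

/-- Each of `k` successive disjoint blocks of unit `ℓ¹` mass adds at most `C ^ 2 + 1` to the squared
norm, whereas a lower estimate would force it up to `(δ * k) ^ 2`. -/
theorem not_hasLowerL1Estimate_of_exists_almost_orthogonal {V : Type*} [NormedAddCommGroup V]
    [NormedSpace ℝ V] {v : ℕ → V} {C : ℝ} (hC : ∀ n, ‖v n‖ ≤ C)
    (h : ∀ (y : V) (N : ℕ), ∃ (t : Finset ℕ) (w : ℕ → ℝ), (∀ i ∈ t, N ≤ i) ∧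
      ∑ i ∈ t, |w i| = 1 ∧
      ‖y + ∑ i ∈ t, w i • v i‖ ^ 2 ≤ ‖y‖ ^ 2 + ‖∑ i ∈ t, w i • v i‖ ^ 2 + 1)
    {δ : ℝ} (hδ : 0 < δ) : ¬ HasLowerL1Estimate δ v := by
  classical
  intro hv
  have key : ∀ k : ℕ, ∃ (s : Finset ℕ) (u : ℕ → ℝ), ∑ i ∈ s, |u i| = k ∧
      ‖∑ i ∈ s, u i • v i‖ ^ 2 ≤ k * (C ^ 2 + 1) := by
    intro k
    induction k with
    | zero => exact ⟨∅, 0, by simp, by simp⟩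
    | succ k ih =>
      obtain ⟨s, u, hsu, hle⟩ := ih
      obtain ⟨N, hN⟩ := s.exists_nat_subset_range
      obtain ⟨t, w, ht, hw, hle'⟩ := h (∑ i ∈ s, u i • v i) N
      have hdisj : Disjoint s t := by
        rw [Finset.disjoint_left]
        intro i hi hi'
        exact absurd (Finset.mem_range.1 (hN hi)) (ht i hi').not_gt
      have hts : ∀ i ∈ t, i ∉ s := fun i hi hi' => Finset.disjoint_left.1 hdisj hi' hi
      refine ⟨s ∪ t, fun i => if i ∈ s then u i else w i, ?_, ?_⟩
      · rw [Finset.sum_union hdisj, Nat.cast_succ, ← hsu, ← hw]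
        exact congrArg₂ _ (Finset.sum_congr rfl fun i hi => by simp only [if_pos hi])
          (Finset.sum_congr rfl fun i hi => by simp only [if_neg (hts i hi)])
      · have e : ∑ i ∈ s ∪ t, (if i ∈ s then u i else w i) • v i =
            ∑ i ∈ s, u i • v i + ∑ i ∈ t, w i • v i := by
          rw [Finset.sum_union hdisj]
          exact congrArg₂ _ (Finset.sum_congr rfl fun i hi => by rw [if_pos hi])
            (Finset.sum_congr rfl fun i hi => by rw [if_neg (hts i hi)])
        beta_reduce
        rw [e]
        have hwC : ‖∑ i ∈ t, w i • v i‖ ≤ C := by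
          calc ‖∑ i ∈ t, w i • v i‖ ≤ ∑ i ∈ t, ‖w i • v i‖ := norm_sum_le _ _
            _ ≤ ∑ i ∈ t, |w i| * C := Finset.sum_le_sum fun i _ => by
              rw [norm_smul, Real.norm_eq_abs]
              exact mul_le_mul_of_nonneg_left (hC i) (abs_nonneg _)
            _ = C := by rw [← Finset.sum_mul, hw, one_mul]
        have hwC2 : ‖∑ i ∈ t, w i • v i‖ ^ 2 ≤ C ^ 2 :=
          pow_le_pow_left₀ (norm_nonneg _) hwC 2
        push_cast
        linarith
  obtain ⟨k, hk⟩ := exists_nat_gt ((C ^ 2 + 1) / δ ^ 2)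
  obtain ⟨s, u, hsu, hle⟩ := key k
  have h1 := hv s u
  rw [hsu] at h1
  have h2 : (δ * k) ^ 2 ≤ k * (C ^ 2 + 1) :=
    (pow_le_pow_left₀ (by positivity) h1 2).trans hle
  rw [div_lt_iff₀ (by positivity)] at hk
  have hk0 : (0 : ℝ) < k := by
    by_contra! h0
    have : (0 : ℝ) < C ^ 2 + 1 := by positivity
    nlinarith [sq_nonneg δ]
  nlinarith

/-- A fixed square summable sequence is almost orthogonal to the bounded sequences in `ℓ²` which
are coordinatewise small. -/
theorem exists_tsum_add_sq_le {a : ℕ → ℝ} (ha : ∀ n, 0 ≤ a n) (hs : Summable fun n => a n ^ 2)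
    (D : ℝ) {η : ℝ} (hη : 0 < η) : ∃ ε > 0, ∀ b : ℕ → ℝ, (∀ n, 0 ≤ b n) →
      (Summable fun n => b n ^ 2) → ∑' n, b n ^ 2 ≤ D → (∀ n, b n ≤ 2 ^ n * ε) →
      (∑' n, (a n + b n) ^ 2) ≤ ∑' n, a n ^ 2 + ∑' n, b n ^ 2 + η := by
  set l := η / (3 * (|D| + 1)) with hl
  have hl0 : 0 < l := by positivity
  obtain ⟨N, hN⟩ : ∃ N, ∑' n, a (n + N) ^ 2 < l * (η / 3) :=
    ((tendsto_sum_nat_add fun n => a n ^ 2).eventually_lt_const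
      (show 0 < l * (η / 3) by positivity)).exists
  set K := ∑ n ∈ Finset.range N, 2 * 2 ^ n * a n with hK
  have hK0 : 0 ≤ K := Finset.sum_nonneg fun n _ => by have := ha n; positivity
  refine ⟨η / (3 * (K + 1)), by positivity, fun b hb hbs hbD hbε => ?_⟩
  set ε := η / (3 * (K + 1)) with hε
  have hε0 : 0 < ε := by positivity
  -- The cross terms `2 * a n * b n` are controlled by smallness of `b` for `n < N`, and by `l * b n
  -- ^ 2 + a n ^ 2 / l` beyond. The head, the tail of `a` and the multiple `l` of `∑ b n ^ 2` each
  -- cost at most `η / 3`.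
  let c : ℕ → ℝ := fun n => if n < N then 2 * 2 ^ n * a n * ε else a n ^ 2 / l
  have hcN : ∀ n, c (n + N) = a (n + N) ^ 2 / l := fun n => if_neg (by omega)
  have hcs : Summable c := by
    rw [← summable_nat_add_iff N]
    simp only [hcN]
    exact ((summable_nat_add_iff N).2 hs).div_const l
  have hc : ∑' n, c n ≤ 2 * (η / 3) := by
    rw [← hcs.sum_add_tsum_nat_add N]
    have h1 : ∑ n ∈ Finset.range N, c n = K * ε := by
      rw [hK, Finset.sum_mul]
      exact Finset.sum_congr rfl fun n hn => if_pos (Finset.mem_range.1 hn)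
    have h2 : K * ε ≤ η / 3 := by
      rw [hε, mul_div_assoc', div_le_div_iff₀ (by positivity) (by positivity)]
      nlinarith
    have h3 : ∑' n, c (n + N) ≤ η / 3 := by
      simp only [hcN]
      rw [tsum_div_const, div_le_iff₀ hl0]
      linarith
    linarith
  have hterm : ∀ n, (a n + b n) ^ 2 ≤ a n ^ 2 + (1 + l) * b n ^ 2 + c n := by
    intro n
    have hb0 := hb n
    have ha0 := ha n
    by_cases hn : n < N
    · have : c n = 2 * 2 ^ n * a n * ε := if_pos hn
      rw [this]
      have h1 : a n * b n ≤ a n * (2 ^ n * ε) := mul_le_mul_of_nonneg_left (hbε n) ha0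
      have h2 : 0 ≤ l * b n ^ 2 := by positivity
      nlinarith
    · have : c n = a n ^ 2 / l := if_neg hn
      rw [this]
      have h1 : 2 * (a n * b n) ≤ l * b n ^ 2 + a n ^ 2 / l := by
        have : l * b n ^ 2 + a n ^ 2 / l - 2 * (a n * b n) = (a n - l * b n) ^ 2 / l := by
          field_simp
          ring
        have h2 : 0 ≤ (a n - l * b n) ^ 2 / l := by positivity
        linarith
      nlinarith
  have hsum : Summable fun n => a n ^ 2 + (1 + l) * b n ^ 2 + c n :=
    (hs.add (hbs.mul_left _)).add hcs
  have h1 : ∑' n, (a n + b n) ^ 2 ≤ ∑' n, (a n ^ 2 + (1 + l) * b n ^ 2 + c n) :=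
    (Summable.of_nonneg_of_le (fun n => sq_nonneg _) hterm hsum).tsum_le_tsum hterm hsum
  rw [(hs.add (hbs.mul_left _)).tsum_add hcs, hs.tsum_add (hbs.mul_left _), tsum_mul_left] at h1
  have h2 : l * ∑' n, b n ^ 2 ≤ η / 3 := by
    calc l * ∑' n, b n ^ 2 ≤ l * (|D| + 1) := by
          gcongr; linarith [le_abs_self D]
      _ = η / 3 := by rw [hl]; field_simp
  linarith

/-! ## The interpolation space of Davis, Figiel, Johnson and Pełczyński -/

/-- A bounded absolutely convex set containing the origin. -/
structure BoundedDisc (E : Type*) [NormedAddCommGroup E] [NormedSpace ℝ E] where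
  carrier : Set E
  absConvex : AbsConvex ℝ carrier
  zero_mem : 0 ∈ carrier
  bound : ℝ
  norm_le : ∀ w ∈ carrier, ‖w‖ ≤ bound

namespace BoundedDisc

open scoped Pointwise

variable {E : Type v} [NormedAddCommGroup E] [NormedSpace ℝ E] (B : BoundedDisc E)

theorem bound_nonneg : 0 ≤ B.bound := (norm_nonneg _).trans (B.norm_le 0 B.zero_mem)

/-- The unit ball of the `n`-th interpolation norm. -/
def levelBall (n : ℕ) : Set E := (2 ^ n : ℝ) • B.carrier + Metric.ball 0 (2 ^ n)⁻¹

/-- The `n`-th interpolation norm. -/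
noncomputable def levelNorm (n : ℕ) : E → ℝ := gauge (B.levelBall n)

theorem balanced_levelBall (n : ℕ) : Balanced ℝ (B.levelBall n) :=
  (B.absConvex.1.smul _).add balanced_ball_zero

theorem convex_levelBall (n : ℕ) : Convex ℝ (B.levelBall n) :=
  (B.absConvex.2.smul _).add (convex_ball 0 _)

theorem ball_subset_levelBall (n : ℕ) : Metric.ball (0 : E) (2 ^ n)⁻¹ ⊆ B.levelBall n :=
  fun x hx => ⟨0, ⟨0, B.zero_mem, smul_zero _⟩, x, hx, zero_add x⟩

theorem absorbent_levelBall (n : ℕ) : Absorbent ℝ (B.levelBall n) :=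
  (absorbent_ball_zero (by positivity)).mono (B.ball_subset_levelBall n)

/-- The constant in the upper bound of the given norm by the `n`-th interpolation norm. -/
noncomputable def levelConst (n : ℕ) : ℝ := 2 ^ n * B.bound + (2 ^ n)⁻¹

theorem levelConst_pos (n : ℕ) : 0 < B.levelConst n := by
  have := B.bound_nonneg
  unfold levelConst
  positivity

theorem levelBall_subset_closedBall (n : ℕ) :
    B.levelBall n ⊆ Metric.closedBall 0 (B.levelConst n) := by
  rintro _ ⟨_, ⟨w, hw, rfl⟩, r, hr, rfl⟩
  rw [mem_ball_zero_iff] at hr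
  rw [mem_closedBall_zero_iff]
  refine (norm_add_le _ _).trans (add_le_add ?_ hr.le)
  simp only [norm_smul, norm_pow, Real.norm_ofNat]
  gcongr
  exact B.norm_le w hw

theorem levelNorm_nonneg (n : ℕ) (x : E) : 0 ≤ B.levelNorm n x := gauge_nonneg x

theorem levelNorm_add_le (n : ℕ) (x y : E) :
    B.levelNorm n (x + y) ≤ B.levelNorm n x + B.levelNorm n y :=
  gauge_add_le (B.convex_levelBall n) (B.absorbent_levelBall n) x y

theorem levelNorm_smul (n : ℕ) (c : ℝ) (x : E) :
    B.levelNorm n (c • x) = ‖c‖ * B.levelNorm n x :=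
  gauge_smul (B.balanced_levelBall n) c x

theorem levelNorm_le (n : ℕ) (x : E) : B.levelNorm n x ≤ 2 ^ n * ‖x‖ := by
  have := mul_gauge_le_norm (B.ball_subset_levelBall n) (x := x)
  rwa [inv_mul_le_iff₀ (by positivity)] at this

theorem norm_le_levelNorm (n : ℕ) (x : E) : ‖x‖ ≤ B.levelConst n * B.levelNorm n x := by
  have := le_gauge_of_subset_closedBall (B.absorbent_levelBall n) (B.levelConst_pos n).le
    (B.levelBall_subset_closedBall n) (x := x)
  rwa [div_le_iff₀' (B.levelConst_pos n)] at this

theorem levelNorm_le_of_mem (n : ℕ) {w : E} (hw : w ∈ B.carrier) :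
    B.levelNorm n w ≤ (2 ^ n)⁻¹ := by
  refine gauge_le_of_mem (by positivity) ⟨(2 ^ n : ℝ) • w, ?_, ?_⟩
  · exact ⟨_, ⟨w, hw, rfl⟩, 0, by simp, add_zero _⟩
  · exact inv_smul_smul₀ (by positivity) w

theorem levelNorm_map_le {σ : E →L[ℝ] E} (hσ : ‖σ‖ ≤ 1) (hσB : ∀ w ∈ B.carrier, σ w ∈ B.carrier)
    (n : ℕ) (x : E) : B.levelNorm n (σ x) ≤ B.levelNorm n x := by
  refine le_of_forall_gt fun a ha => ?_
  obtain ⟨b, hb, hba, y, hy, hyx⟩ := exists_lt_of_gauge_lt (B.absorbent_levelBall n) ha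
  refine lt_of_le_of_lt (gauge_le_of_mem hb.le ⟨σ y, ?_, ?_⟩) hba
  · obtain ⟨_, ⟨w, hw, rfl⟩, r, hr, rfl⟩ := hy
    refine ⟨(2 ^ n : ℝ) • σ w, ⟨_, hσB w hw, rfl⟩, σ r, ?_, ?_⟩
    · rw [mem_ball_zero_iff] at hr ⊢
      exact (σ.le_of_opNorm_le hσ r).trans_lt (by rwa [one_mul])
    · simp [map_add, map_smul]
  · rw [← hyx]
    exact (map_smul σ b y).symm

/-- The multiplier `a * 2 ^ n` depends only on the bound `a`: the disc is balanced and absorbs the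
factor `b / a`. Hence a bounded sequence of the interpolation space is approximated by one and the
same multiple of the disc, with an error that vanishes as `n` grows. -/
theorem exists_approx_of_levelNorm_lt (n : ℕ) {x : E} {a : ℝ} (hx : B.levelNorm n x < a) :
    ∃ w ∈ B.carrier, ‖x - (a * 2 ^ n) • w‖ ≤ a * (2 ^ n)⁻¹ := by
  obtain ⟨b, hb, hba, _, ⟨_, ⟨w, hw, rfl⟩, r, hr, rfl⟩, rfl⟩ :=
    exists_lt_of_gauge_lt (B.absorbent_levelBall n) hx
  have ha : 0 < a := hb.trans hba
  refine ⟨(b / a) • w, B.absConvex.1.smul_mem (by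
    rw [Real.norm_of_nonneg (by positivity)]; exact div_le_one_of_le₀ hba.le ha.le) hw, ?_⟩
  rw [mem_ball_zero_iff] at hr
  have e : b • ((2 ^ n : ℝ) • w + r) - (a * 2 ^ n) • (b / a) • w = b • r := by
    have : a * 2 ^ n * (b / a) = b * 2 ^ n := by field_simp
    rw [smul_smul, this, smul_add, smul_smul]
    abel
  simp only [e]
  rw [norm_smul, Real.norm_of_nonneg hb.le]
  exact mul_le_mul hba.le hr.le (norm_nonneg _) ha.le

/-- The given space with its `n`-th interpolation norm. -/
def Level (_B : BoundedDisc E) (_n : ℕ) : Type v := E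

instance (n : ℕ) : AddCommGroup (B.Level n) := inferInstanceAs (AddCommGroup E)

instance (n : ℕ) : Module ℝ (B.Level n) := inferInstanceAs (Module ℝ E)

noncomputable instance (n : ℕ) : Norm (B.Level n) := ⟨B.levelNorm n⟩

theorem levelCore (n : ℕ) : NormedSpace.Core ℝ (B.Level n) where
  norm_nonneg := B.levelNorm_nonneg n
  norm_smul := B.levelNorm_smul n
  norm_triangle := B.levelNorm_add_le n
  norm_eq_zero_iff x := by
    constructor
    · intro hx
      have := B.norm_le_levelNorm n x
      rw [show B.levelNorm n x = 0 from hx, mul_zero] at this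
      exact norm_le_zero_iff.1 this
    · rintro rfl
      exact gauge_zero

noncomputable instance (n : ℕ) : NormedAddCommGroup (B.Level n) :=
  NormedAddCommGroup.ofCore (B.levelCore n)

noncomputable instance (n : ℕ) : NormedSpace ℝ (B.Level n) where
  norm_smul_le c x := (B.levelNorm_smul n c x).le

/-- The identity as an isomorphism from the interpolation norm to the given norm. -/
noncomputable def levelEquiv (n : ℕ) : B.Level n ≃L[ℝ] E :=
  LinearEquiv.toContinuousLinearEquivOfBounds
    ({ toFun := fun x => x, invFun := fun x => x, map_add' := fun _ _ => rfl
       map_smul' := fun _ _ => rfl } : B.Level n ≃ₗ[ℝ] E)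
    (B.levelConst n) (2 ^ n) (B.norm_le_levelNorm n) (B.levelNorm_le n)

theorem norm_levelEquiv_symm (n : ℕ) (x : E) : ‖(B.levelEquiv n).symm x‖ = B.levelNorm n x := rfl

theorem norm_level (n : ℕ) (x : B.Level n) : ‖x‖ = B.levelNorm n (B.levelEquiv n x) := rfl

instance [CompleteSpace E] (n : ℕ) : CompleteSpace (B.Level n) :=
  (completeSpace_congr (e := (B.levelEquiv n).toEquiv) (B.levelEquiv n).isUniformEmbedding).2
    inferInstance

/-- The evaluation of the `ℓ²`-sum of the levels, with values in the given space. -/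
noncomputable def evalLevel (n : ℕ) : lp B.Level 2 →L[ℝ] E :=
  (B.levelEquiv n : B.Level n →L[ℝ] E) ∘L lp.evalCLM ℝ B.Level 2 n

/-- The interpolation space, as the diagonal of the `ℓ²`-sum of the levels. -/
noncomputable def interp : Submodule ℝ (lp B.Level 2) where
  carrier := {z | ∀ n, B.evalLevel n z = B.evalLevel 0 z}
  add_mem' hx hy n := by rw [map_add, map_add, hx n, hy n]
  zero_mem' n := by rw [map_zero, map_zero]
  smul_mem' c x hx n := by rw [map_smul, map_smul, hx n]

theorem isClosed_interp : IsClosed (B.interp : Set (lp B.Level 2)) := by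
  have : (B.interp : Set (lp B.Level 2)) = ⋂ n, {z | B.evalLevel n z = B.evalLevel 0 z} := by
    ext z
    simp [interp]
  rw [this]
  exact isClosed_iInter fun n => isClosed_eq (B.evalLevel n).continuous (B.evalLevel 0).continuous

instance [CompleteSpace E] : CompleteSpace B.interp := B.isClosed_interp.completeSpace_coe

/-- The inclusion of the interpolation space into the given space. -/
noncomputable def incl : B.interp →L[ℝ] E := B.evalLevel 0 ∘L B.interp.subtypeL

theorem levelEquiv_apply (z : B.interp) (n : ℕ) : B.levelEquiv n (z.1 n) = B.incl z := z.2 n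

theorem norm_apply (z : B.interp) (n : ℕ) : ‖z.1 n‖ = B.levelNorm n (B.incl z) := by
  rw [norm_level, levelEquiv_apply]

theorem summable_levelNorm (z : B.interp) : Summable fun n => B.levelNorm n (B.incl z) ^ 2 := by
  have := (lp.memℓp z.1).summable (by simp)
  simpa [norm_apply] using this

theorem norm_sq (z : B.interp) : ‖z‖ ^ 2 = ∑' n, B.levelNorm n (B.incl z) ^ 2 := by
  have := lp.norm_rpow_eq_tsum (p := 2) (by simp) z.1
  simpa [norm_apply] using this

theorem levelNorm_incl_le (z : B.interp) (n : ℕ) : B.levelNorm n (B.incl z) ≤ ‖z‖ := by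
  rw [← norm_apply]
  exact lp.norm_apply_le_norm two_ne_zero z.1 n

theorem incl_injective : Function.Injective B.incl := by
  intro x y hxy
  refine Subtype.ext (lp.ext (funext fun n => (B.levelEquiv n).injective ?_))
  rw [levelEquiv_apply, levelEquiv_apply, hxy]

theorem exists_incl_eq {x : E} (hx : Summable fun n => B.levelNorm n x ^ 2) :
    ∃ z : B.interp, B.incl z = x := by
  have hm : Memℓp (fun n => (B.levelEquiv n).symm x) 2 := by
    refine memℓp_gen ?_
    simpa [norm_levelEquiv_symm] using hx
  exact ⟨⟨⟨_, hm⟩, fun n => rfl⟩, rfl⟩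

theorem exists_incl_eq_of_mem {w : E} (hw : w ∈ B.carrier) : ∃ z : B.interp, B.incl z = w := by
  refine B.exists_incl_eq (Summable.of_nonneg_of_le (fun n => sq_nonneg _) (fun n =>
    pow_le_pow_left₀ (B.levelNorm_nonneg n w) (B.levelNorm_le_of_mem n hw) 2) ?_)
  have : (fun n : ℕ => ((2 ^ n : ℝ)⁻¹) ^ 2) = fun n => ((1 : ℝ) / 4) ^ n := by
    funext n
    rw [one_div, inv_pow, inv_pow, ← pow_mul, mul_comm, pow_mul]
    norm_num
  rw [this]
  exact summable_geometric_of_lt_one (by norm_num) (by norm_num)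

theorem norm_le_of_levelNorm_le {y z : B.interp}
    (h : ∀ n, B.levelNorm n (B.incl y) ≤ B.levelNorm n (B.incl z)) : ‖y‖ ≤ ‖z‖ := by
  refine (pow_le_pow_iff_left₀ (norm_nonneg y) (norm_nonneg z) two_ne_zero).1 ?_
  rw [norm_sq, norm_sq]
  exact (B.summable_levelNorm y).tsum_le_tsum
    (fun n => pow_le_pow_left₀ (B.levelNorm_nonneg n _) (h n) 2) (B.summable_levelNorm z)

/-- A contraction that preserves the disc acts on the interpolation space. -/
theorem exists_lift {σ : E →L[ℝ] E} (hσ : ‖σ‖ ≤ 1)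
    (hσB : ∀ w ∈ B.carrier, σ w ∈ B.carrier) :
    ∃ τ : B.interp →L[ℝ] B.interp, ‖τ‖ ≤ 1 ∧ ∀ z, B.incl (τ z) = σ (B.incl z) := by
  have hex : ∀ z : B.interp, ∃ y : B.interp, B.incl y = σ (B.incl z) := fun z =>
    B.exists_incl_eq (Summable.of_nonneg_of_le (fun n => sq_nonneg _) (fun n =>
      pow_le_pow_left₀ (B.levelNorm_nonneg n _) (B.levelNorm_map_le hσ hσB n _) 2)
      (B.summable_levelNorm z))
  choose τ hτ using hex
  let τ₀ : B.interp →ₗ[ℝ] B.interp :=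
    { toFun := τ
      map_add' := fun y z => B.incl_injective (by simp only [hτ, map_add])
      map_smul' := fun c z => B.incl_injective (by simp only [hτ, map_smul, RingHom.id_apply]) }
  refine ⟨τ₀.mkContinuous 1 fun z => ?_, τ₀.mkContinuous_norm_le zero_le_one _, hτ⟩
  rw [one_mul]
  refine B.norm_le_of_levelNorm_le fun n => ?_
  have : B.incl (τ₀ z) = σ (B.incl z) := hτ z
  rw [this]
  exact B.levelNorm_map_le hσ hσB n _

/-- If no sequence approximable by multiples of the disc satisfies a lower `ℓ¹`-estimate in the
given norm then the interpolation space contains no copy of `ℓ¹`. -/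
theorem isRosenthalSpace_interp (hB : ∀ v : ℕ → E,
    (∀ η > 0, ∃ M : ℝ, 0 < M ∧ ∀ i, ∃ w ∈ B.carrier, ‖v i - M • w‖ ≤ η) →
      ∀ δ > 0, ¬ HasLowerL1Estimate δ v) : IsRosenthalSpace B.interp := by
  classical
  rintro ⟨T, hT⟩
  obtain ⟨v, δ, C, hδ, hv, hC⟩ := exists_hasLowerL1Estimate_of_isEmbedding T hT
  have hC0 : 0 ≤ C := (norm_nonneg _).trans (hC 0)
  refine not_hasLowerL1Estimate_of_exists_almost_orthogonal hC (fun y N => ?_) hδ hv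
  obtain ⟨ε, hε, hεb⟩ := exists_tsum_add_sq_le
    (fun n => B.levelNorm_nonneg n (B.incl y)) (B.summable_levelNorm y) (C ^ 2) one_pos
  -- The tail beyond `N` is used so that the new block is disjoint from the earlier ones. Its
  -- included sequence has no lower estimate with constant `ε`, which yields a combination small in
  -- the norm of `E`.
  have hnot := hB (fun i => B.incl (v (i + N))) (fun η hη => by
    obtain ⟨n, hn⟩ := exists_pow_lt_of_lt_one (show 0 < η / (C + 1) by positivity)
      (show (2⁻¹ : ℝ) < 1 by norm_num)
    refine ⟨(C + 1) * 2 ^ n, by positivity, fun i => ?_⟩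
    obtain ⟨w, hw, hwle⟩ := B.exists_approx_of_levelNorm_lt n (a := C + 1)
      (lt_of_le_of_lt ((B.levelNorm_incl_le _ n).trans (hC (i + N))) (lt_add_one C))
    refine ⟨w, hw, hwle.trans ?_⟩
    rw [lt_div_iff₀ (by positivity), inv_pow] at hn
    linarith) ε hε
  obtain ⟨s, u, hsu⟩ : ∃ (s : Finset ℕ) (u : ℕ → ℝ),
      ‖∑ i ∈ s, u i • B.incl (v (i + N))‖ < ε * ∑ i ∈ s, |u i| := by
    by_contra! h
    exact hnot h
  set r := ∑ i ∈ s, |u i| with hr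
  have hr0 : 0 < r := by
    have := (norm_nonneg _).trans_lt hsu
    exact pos_of_mul_pos_right this hε.le
  refine ⟨s.map (addRightEmbedding N), fun i => u (i - N) / r, ?_, ?_, ?_⟩
  · intro i hi
    obtain ⟨j, -, rfl⟩ := Finset.mem_map.1 hi
    exact Nat.le_add_left N j
  · simp only [Finset.sum_map, addRightEmbedding_apply, Nat.add_sub_cancel, abs_div, abs_of_pos hr0]
    rw [← Finset.sum_div, ← hr, div_self hr0.ne']
  · simp only [Finset.sum_map, addRightEmbedding_apply, Nat.add_sub_cancel]
    -- Smallness of `z` in `E` makes each level norm at most `2 ^ n * ε`, as almost orthogonality to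
    -- `y` requires.
    set z := ∑ i ∈ s, (u i / r) • v (i + N) with hz
    have hzC : ‖z‖ ≤ C := by
      calc ‖z‖ ≤ ∑ i ∈ s, ‖(u i / r) • v (i + N)‖ := norm_sum_le _ _
        _ ≤ ∑ i ∈ s, |u i| / r * C := Finset.sum_le_sum fun i _ => by
          rw [norm_smul, Real.norm_eq_abs, abs_div, abs_of_pos hr0]
          exact mul_le_mul_of_nonneg_left (hC _) (by positivity)
        _ = C := by rw [← Finset.sum_mul, ← Finset.sum_div, ← hr, div_self hr0.ne', one_mul]
    have hzε : ‖B.incl z‖ ≤ ε := by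
      have e : B.incl z = r⁻¹ • ∑ i ∈ s, u i • B.incl (v (i + N)) := by
        rw [hz, map_sum, Finset.smul_sum]
        refine Finset.sum_congr rfl fun i _ => ?_
        rw [map_smul, smul_smul, div_eq_inv_mul]
      rw [e, norm_smul, Real.norm_of_nonneg (by positivity), inv_mul_le_iff₀ hr0, mul_comm]
      exact hsu.le
    have key := hεb (fun n => B.levelNorm n (B.incl z)) (fun n => B.levelNorm_nonneg n _)
      (B.summable_levelNorm z) (by
        rw [← norm_sq]; exact pow_le_pow_left₀ (norm_nonneg _) hzC 2)
      (fun n => (B.levelNorm_le n _).trans (by gcongr))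
    rw [← norm_sq, ← norm_sq] at key
    refine le_trans ?_ key
    rw [norm_sq]
    have hle : ∀ n, B.levelNorm n (B.incl (y + z)) ^ 2 ≤
        (B.levelNorm n (B.incl y) + B.levelNorm n (B.incl z)) ^ 2 := fun n => by
      rw [map_add]
      exact pow_le_pow_left₀ (B.levelNorm_nonneg n _) (B.levelNorm_add_le n _ _) 2
    refine (B.summable_levelNorm _).tsum_le_tsum hle ?_
    refine Summable.of_nonneg_of_le (fun n => sq_nonneg _) (fun n => add_sq_le)
      (((B.summable_levelNorm y).add (B.summable_levelNorm z)).mul_left 2)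

end BoundedDisc

/-! ### Non-oscillating subshifts and Rosenthal representations. -/

namespace Subshift

variable {S : Type u} {A : Type v} [Monoid S] [TopologicalSpace A]

/-- The sequence `s` may repeat values. If it takes finitely many on `N`, one of them recurs
infinitely often; otherwise one index is kept for each value, and the set `K` inside the image is
pulled back. -/
theorem IsNonOscillating.exists_subseq {X : Subshift S A} (hX : X.IsNonOscillating) (s : ℕ → S)
    {N : Set ℕ} (hN : N.Infinite) : ∃ k : ℕ → ℕ, StrictMono k ∧ (∀ n, k n ∈ N) ∧
      ∀ x ∈ X.carrier, ∃ c, ∀ᶠ n in Filter.atTop, x (s (k n)) = c := by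
  obtain ⟨N', hN'N, hN', hx⟩ : ∃ N' ⊆ N, N'.Infinite ∧ ∀ x ∈ X.carrier, ∃ c,
      {n ∈ N' | x (s n) ≠ c}.Finite := by
    by_cases hfin : (s '' N).Finite
    · have := hfin.to_subtype
      obtain ⟨r, hr⟩ := Set.Infinite.exists_infinite_fiber
        (infinite_univ_iff.2 hN.to_subtype) (fun n : N => (⟨s n, n, n.2, rfl⟩ : s '' N))
      refine ⟨{n ∈ N | s n = r}, fun n hn => hn.1, fun hf => hr ?_, fun x _ => ⟨x r, ?_⟩⟩
      · refine Set.Finite.of_finite_image (hf.subset ?_) (Subtype.val_injective.injOn)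
        rintro _ ⟨n, ⟨-, hn⟩, rfl⟩
        exact ⟨n.2, congrArg Subtype.val hn⟩
      · convert Set.finite_empty
        ext n
        simp only [mem_ofPred_eq, mem_empty_iff_false, iff_false, not_and, not_not]
        rintro ⟨-, hn⟩
        rw [hn]
    · obtain ⟨K, hKL, hK, hx⟩ := hX _ hfin
      obtain ⟨M, hMN, hM⟩ := Set.exists_subset_bijOn N s
      refine ⟨{n ∈ M | s n ∈ K}, fun n hn => hMN hn.1, fun hf => hK ((hf.image s).subset ?_),
        fun x hxX => ?_⟩
      · intro r hr
        obtain ⟨n, hn, rfl⟩ := hM.surjOn (hKL hr)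
        exact ⟨n, ⟨hn, hr⟩, rfl⟩
      · obtain ⟨c, hc⟩ := hx x hxX
        refine ⟨c, Set.Finite.of_finite_image (f := s) (hc.subset ?_)
          (hM.injOn.mono fun n hn => hn.1.1)⟩
        rintro _ ⟨n, hn, rfl⟩
        exact ⟨hn.1.2, hn.2⟩
  obtain ⟨k, hk, hkN⟩ := Filter.extraction_of_frequently_atTop
    (Nat.frequently_atTop_iff_infinite.2 hN')
  refine ⟨k, hk, fun n => hN'N (hkN n), fun x hxX => ?_⟩
  obtain ⟨c, hc⟩ := hx x hxX
  refine ⟨c, ?_⟩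
  rw [← Nat.cofinite_eq_atTop]
  refine Set.Finite.of_finite_image (f := k) (hc.subset ?_) hk.injective.injOn
  rintro _ ⟨n, hn, rfl⟩
  exact ⟨hkN n, hn⟩

/-- The action of an element of the monoid on `C(X)`. -/
noncomputable def compSMul [Finite A] (X : Subshift S A) (s : S) :
    C(X.Points, ℝ) →L[ℝ] C(X.Points, ℝ) :=
  LinearMap.mkContinuous
    { toFun := fun f => f.comp ⟨fun x => s • x, continuous_const_smul s⟩
      map_add' := fun _ _ => rfl
      map_smul' := fun _ _ => rfl } 1 fun f => by
    rw [one_mul, ContinuousMap.norm_le _ (norm_nonneg f)]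
    exact fun x => f.norm_coe_le_norm (s • x)

theorem compSMul_apply [Finite A] (X : Subshift S A) (s : S) (f : C(X.Points, ℝ)) (x : X.Points) :
    X.compSMul s f x = f (s • x) := rfl

theorem norm_compSMul_le [Finite A] (X : Subshift S A) (s : S) : ‖X.compSMul s‖ ≤ 1 :=
  LinearMap.mkContinuous_norm_le _ zero_le_one _

variable [DiscreteTopology A] (X : Subshift S A)

/-- The family of the coordinate indicators. -/
def indicators : Set C(X.Points, ℝ) := range fun p : S × Set A => X.coordIndicator p.1 p.2

theorem abs_coordIndicator_le (s : S) (P : Set A) (x : X.Points) :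
    |X.coordIndicator s P x| ≤ 1 := by
  rw [coordIndicator_apply]
  split_ifs <;> simp

theorem coordIndicator_empty (s : S) : X.coordIndicator s ∅ = 0 := by
  ext x
  simp [coordIndicator_apply]

variable [Finite A]

/-- The absolutely convex hull of the coordinate indicators. -/
noncomputable def disc : BoundedDisc C(X.Points, ℝ) where
  carrier := absConvexHull ℝ X.indicators
  absConvex := absConvex_absConvexHull
  -- Indicators of all subsets of the alphabet are admitted, so that of `∅` supplies zero.
  zero_mem := subset_absConvexHull ⟨(1, ∅), X.coordIndicator_empty 1⟩
  bound := 1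
  norm_le w hw := by
    have : absConvexHull ℝ X.indicators ⊆ Metric.closedBall 0 1 := by
      refine absConvexHull_min ?_ ⟨balanced_closedBall_zero, convex_closedBall 0 1⟩
      rintro _ ⟨p, rfl⟩
      rw [mem_closedBall_zero_iff, ContinuousMap.norm_le _ zero_le_one]
      exact X.abs_coordIndicator_le p.1 p.2
    simpa using this hw

theorem compSMul_mem_disc (s : S) {w : C(X.Points, ℝ)} (hw : w ∈ X.disc.carrier) :
    X.compSMul s w ∈ X.disc.carrier := by
  have : absConvexHull ℝ X.indicators ⊆ X.compSMul s ⁻¹' absConvexHull ℝ X.indicators := by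
    refine absConvexHull_min ?_ ⟨?_, ?_⟩
    · rintro _ ⟨p, rfl⟩
      exact subset_absConvexHull ⟨(p.1 * s, p.2), rfl⟩
    · rintro a ha _ ⟨f, hf, rfl⟩
      rw [mem_preimage] at hf ⊢
      simp only [map_smul]
      exact balanced_absConvexHull.smul_mem ha hf
    · exact (convex_absConvexHull (𝕜 := ℝ)).linear_preimage
        (X.compSMul s : C(X.Points, ℝ) →ₗ[ℝ] C(X.Points, ℝ))
  exact this hw

/-- Along a subsequence the subset of the alphabet is fixed, as there are finitely many, and the
coordinates of each point are eventually constant. Consecutive differences of the indicators then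
eventually vanish at each point. -/
theorem IsNonOscillating.isRosenthalSpace {X : Subshift S A} (hX : X.IsNonOscillating) :
    IsRosenthalSpace X.disc.interp := by
  refine X.disc.isRosenthalSpace_interp fun v hv δ hδ =>
    not_hasLowerL1Estimate_of_approx (F := X.indicators) (C := 1) ?_ ?_ hv hδ
  · rintro _ ⟨p, rfl⟩
    exact X.abs_coordIndicator_le p.1 p.2
  · intro f hf
    choose p hp using hf
    obtain ⟨P, hP⟩ := Set.Infinite.exists_infinite_fiber (infinite_univ (α := ℕ))
      fun n => (p n).2
    obtain ⟨k, hk, hkP, hkx⟩ := hX.exists_subseq (fun n => (p n).1) hP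
    refine ⟨k, hk, fun x => ?_⟩
    obtain ⟨c, hc⟩ := hkx x.1 x.2
    have hfk : ∀ n, f (k n) = X.coordIndicator (p (k n)).1 P := fun n => by
      rw [← hp, ← (hkP n).2]
    refine tendsto_const_nhds.congr' ?_
    filter_upwards [hc, (Filter.tendsto_add_atTop_nat 1).eventually hc] with n h1 h2
    rw [hfk, hfk, coordIndicator_apply, coordIndicator_apply, h1, h2, sub_self]

/-- The representation of a subshift on the interpolation space of its coordinate indicators. -/
theorem exists_representation :
    ∃ ρ : BanachRepresentation S X.Points X.disc.interp, IsEmbedding ρ.α := by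
  choose τ hτ1 hτ using fun s : S => X.disc.exists_lift (X.norm_compSMul_le s)
    fun w hw => X.compSMul_mem_disc s hw
  let h : S →* (X.disc.interp →L[ℝ] X.disc.interp)ᵐᵒᵖ :=
    { toFun := fun s => MulOpposite.op (τ s)
      map_one' := by
        refine MulOpposite.unop_injective (ContinuousLinearMap.ext fun z =>
          X.disc.incl_injective ?_)
        ext x
        simp [hτ, compSMul_apply]
      map_mul' := fun s t => by
        refine MulOpposite.unop_injective (ContinuousLinearMap.ext fun z =>
          X.disc.incl_injective ?_)
        ext x
        simp [hτ, compSMul_apply, mul_smul] }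
  let α : X.Points → WeakDual ℝ X.disc.interp := fun x =>
    StrongDual.toWeakDual (ContinuousMap.evalCLM ℝ x ∘L X.disc.incl)
  have hα : ∀ x v, α x v = X.disc.incl v x := fun _ _ => rfl
  have hcont : Continuous α := by
    refine WeakDual.continuous_of_continuous_eval fun v => ?_
    simp only [hα]
    exact (X.disc.incl v).continuous
  refine ⟨{ h := h, contraction := hτ1, α := α, continuous_α := hcont, bounded_α := ?_,
            equivariant := ?_ }, ?_⟩
  · refine ⟨‖X.disc.incl‖, fun x => ContinuousLinearMap.opNorm_le_bound _
      (norm_nonneg X.disc.incl) ?_⟩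
    intro v
    exact ((X.disc.incl v).norm_coe_le_norm x).trans (X.disc.incl.le_opNorm v)
  · intro s x v
    rw [hα, hα]
    exact (congrArg (fun f : C(X.Points, ℝ) => f x) (hτ s v)).symm
  -- On the compact space, injectivity of `α` suffices. The coordinate indicators belong to the
  -- interpolation space and separate points.
  · refine (hcont.isClosedEmbedding fun x y hxy => ?_).isEmbedding
    refine Subtype.ext (funext fun s => ?_)
    obtain ⟨z, hz⟩ := X.disc.exists_incl_eq_of_mem (w := X.coordIndicator s {x.1 s})
      (subset_absConvexHull ⟨(s, {x.1 s}), rfl⟩)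
    have hzz : α x z = α y z := by rw [hxy]
    rw [hα, hα, hz, coordIndicator_apply, coordIndicator_apply, if_pos (mem_singleton _)] at hzz
    by_contra hne
    rw [if_neg fun h => hne (Eq.symm (mem_singleton_iff.1 h))] at hzz
    exact one_ne_zero hzz

/-- An independent sequence of functions `x ↦ ρ.α (s • x) v` would span a copy of `ℓ¹` along the
bounded vectors `h(s) v`. By compactness, finitely many triples `(v, a, b)` separate all pairs of
points that differ at the coordinate `1`, so finitely many applications of the dichotomy control all
coordinates. -/
theorem isNonOscillating_of_isRosenthalRepresentable {X : Subshift S A}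
    (h : IsRosenthalRepresentable S X.Points) : X.IsNonOscillating := by
  classical
  obtain ⟨V, _, _, _, hV, ρ, hρ⟩ := h
  obtain ⟨C, hC⟩ := ρ.bounded_α
  have hev : ∀ v : V, Continuous fun x => ρ.α x v := fun v =>
    (WeakDual.eval_continuous v).comp ρ.continuous_α
  obtain ⟨T, hT⟩ := exists_finset_forall_pair (X := X.Points) (τ := V × ℝ × ℝ)
    (D := {p | p.1.1 1 ≠ p.2.1 1})
    (by
      have h1 : Continuous fun p : X.Points × X.Points => (p.1.1 (1 : S), p.2.1 (1 : S)) :=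
        ((continuous_apply 1).comp (continuous_subtype_val.comp continuous_fst)).prodMk
          ((continuous_apply 1).comp (continuous_subtype_val.comp continuous_snd))
      exact (isClosed_discrete {q : A × A | q.1 ≠ q.2}).preimage h1)
    (fun t p => t.2.1 < t.2.2 ∧ ((ρ.α p.1 t.1 < t.2.1 ∧ t.2.2 < ρ.α p.2 t.1) ∨
      (ρ.α p.2 t.1 < t.2.1 ∧ t.2.2 < ρ.α p.1 t.1)))
    (fun t => by
      have h1 : Continuous fun p : X.Points × X.Points => ρ.α p.1 t.1 :=
        (hev t.1).comp continuous_fst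
      have h2 : Continuous fun p : X.Points × X.Points => ρ.α p.2 t.1 :=
        (hev t.1).comp continuous_snd
      exact isOpen_const.and (((isOpen_lt h1 continuous_const).inter
        (isOpen_lt continuous_const h2)).union ((isOpen_lt h2 continuous_const).inter
        (isOpen_lt continuous_const h1))))
    (by
      rintro ⟨x, y⟩ hxy
      have hne : ρ.α x ≠ ρ.α y := fun he =>
        hxy (congrArg (fun z : X.Points => z.1 1) (hρ.injective he))
      obtain ⟨v, hv⟩ := DFunLike.exists_ne hne
      rcases lt_or_gt_of_ne hv with hlt | hlt
      · obtain ⟨a, h1, h2⟩ := exists_between hlt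
        obtain ⟨b, h3, h4⟩ := exists_between h2
        exact ⟨(v, a, b), h3, Or.inl ⟨h1, h4⟩⟩
      · obtain ⟨a, h1, h2⟩ := exists_between hlt
        obtain ⟨b, h3, h4⟩ := exists_between h2
        exact ⟨(v, a, b), h3, Or.inr ⟨h1, h4⟩⟩)
  refine isNonOscillating_of_pairwise fun L hL => ?_
  obtain ⟨K, hKL, hK, hQ⟩ := hL.exists_subset_forall_mem_finset
    (fun (t : V × ℝ × ℝ) (K : Set S) => t.2.1 < t.2.2 → ∀ x : X.Points,
      ¬ ({s ∈ K | ρ.α (s • x) t.1 < t.2.1}.Infinite ∧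
        {s ∈ K | t.2.2 < ρ.α (s • x) t.1}.Infinite))
    (fun t K K' hKK' hK ht x hx => hK ht x
      ⟨hx.1.mono fun s hs => ⟨hKK' hs.1, hs.2⟩, hx.2.mono fun s hs => ⟨hKK' hs.1, hs.2⟩⟩)
    T (by
      rintro ⟨v, a, b⟩ _ L hL
      by_cases hab : a < b
      · rcases hL.exists_independent_or_not_oscillating (fun s (x : X.Points) => ρ.α (s • x) v)
          hab with ⟨g, -, hg⟩ | ⟨K, hKL, hK, hx⟩
        · simp only [ρ.equivariant] at hg
          obtain ⟨δ, hδ, hl1⟩ := IsIndependentSeq.hasLowerL1Estimate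
            (v := fun n => (ρ.h (g n)).unop v) (φ := fun x v => ρ.α x v) (C := C) (by
              intro x s u
              have e : ∑ i ∈ s, u i * ρ.α x ((ρ.h (g i)).unop v) =
                  WeakDual.toStrongDual (ρ.α x) (∑ i ∈ s, u i • (ρ.h (g i)).unop v) := by
                simp only [map_sum, map_smul, smul_eq_mul]
                rfl
              rw [e]
              exact (le_abs_self _).trans (ContinuousLinearMap.le_of_opNorm_le _ (hC x) _)) hg
          refine absurd (hl1.isEmbedding_of_bound hδ (C := ‖v‖) fun n => ?_) hV
          simpa using ContinuousLinearMap.le_of_opNorm_le _ (ρ.contraction (g n)) v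
        · exact ⟨K, hKL, hK, fun _ => hx⟩
      · exact ⟨L, Subset.rfl, hL, fun h => absurd h hab⟩)
  refine ⟨K, hKL, hK, fun x hx c d hcd ⟨hc, hd⟩ => ?_⟩
  let y : X.Points := ⟨x, hx⟩
  -- discard the finitely many coordinates where a level is crossed finitely often
  let small : V × ℝ × ℝ → Set S := fun t =>
    (if {s ∈ K | ρ.α (s • y) t.1 < t.2.1}.Finite then {s ∈ K | ρ.α (s • y) t.1 < t.2.1} else ∅) ∪
      (if {s ∈ K | t.2.2 < ρ.α (s • y) t.1}.Finite then {s ∈ K | t.2.2 < ρ.α (s • y) t.1} else ∅)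
  have hsmall : (⋃ t ∈ T, small t).Finite := by
    refine T.finite_toSet.biUnion fun t _ => Set.Finite.union ?_ ?_
    · split_ifs with h
      exacts [h, Set.finite_empty]
    · split_ifs with h
      exacts [h, Set.finite_empty]
  obtain ⟨r, ⟨hrK, hrc⟩, hr⟩ := (hc.sdiff hsmall).nonempty
  obtain ⟨q, ⟨hqK, hqd⟩, hq⟩ := (hd.sdiff hsmall).nonempty
  have hcross : ∀ t ∈ T, t.2.1 < t.2.2 → ∀ r q, r ∈ K → q ∈ K → r ∉ ⋃ t ∈ T, small t →
      q ∉ ⋃ t ∈ T, small t → ρ.α (r • y) t.1 < t.2.1 → t.2.2 < ρ.α (q • y) t.1 → False := by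
    intro t ht htab r q hrK hqK hr hq h1 h2
    refine hQ t ht htab y ⟨fun hf => hr (mem_iUnion₂.2 ⟨t, ht, Or.inl ?_⟩),
      fun hf => hq (mem_iUnion₂.2 ⟨t, ht, Or.inr ?_⟩)⟩
    · rw [if_pos hf]
      exact ⟨hrK, h1⟩
    · rw [if_pos hf]
      exact ⟨hqK, h2⟩
  -- The points `r • y` and `q • y` have the letters `c` and `d` at `1`, so some triple of `T`
  -- separates them; as `r` and `q` avoid the discarded coordinates, both its levels are crossed
  -- infinitely often.
  obtain ⟨t, ht, htab, h1 | h1⟩ := hT (r • y, q • y) (by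
    have e : ∀ s : S, (s • y).1 1 = x s := fun s => congrArg x (one_mul s)
    simp only [mem_ofPred_eq, e]
    rwa [hrc, hqd])
  · exact hcross t ht htab r q hrK hqK hr hq h1.1 h1.2
  · exact hcross t ht htab q r hqK hrK hq hr h1.1 h1.2

end Subshift

/-! ### The equivalence. -/

/-- For a subshift `X ⊆ A^S` (`S` a discrete monoid, `A` a finite alphabet): `(S, X)` is tame iff
every infinite `L ⊆ S` has an infinite subset `K` with `π_K(X) = π_K(Y)` for some countable
`Y ⊆ X`, iff every infinite `L ⊆ S` has an infinite subset `K` with `π_K(X)` countable, iff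
`(S, X)` is Rosenthal representable. Here `K.domRestrict` is the projection `π_K : A^S → A^K`. -/
theorem theorem4p6 {S : Type u} {A : Type v} [Monoid S] [Finite A] [TopologicalSpace A]
    [DiscreteTopology A] (X : Subshift S A) :
    List.TFAE
      [IsTameSystem S X.Points,
       ∀ L : Set S, L.Infinite → ∃ K ⊆ L, K.Infinite ∧
         ∃ Y ⊆ X.carrier, Y.Countable ∧ K.domRestrict '' X.carrier = K.domRestrict '' Y,
       ∀ L : Set S, L.Infinite → ∃ K ⊆ L, K.Infinite ∧ (K.domRestrict '' X.carrier).Countable,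
       IsRosenthalRepresentable S X.Points] := by
  tfae_have 2 ↔ 3 := by
    simp only [X.exists_subset_countable_restrict_iff]
  tfae_have 3 → 1 := Subshift.isTame_of_exists_countable
  tfae_have 1 → 4 := fun h =>
    ⟨X.disc.interp, inferInstance, inferInstance, inferInstance,
      (Subshift.isNonOscillating_of_isTame h).isRosenthalSpace, X.exists_representation⟩
  tfae_have 4 → 3 := fun h =>
    (Subshift.isNonOscillating_of_isRosenthalRepresentable h).exists_countable
  tfae_finish
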